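/- Let $(M,g)$ be a smooth Riemannian manifold (Hausdorff, second countable, of dimension $n\ge 1$, not necessarily complete) with smooth, possibly empty, boundary $\partial M$, interior $\operatorname{int}M$, and exterior unit normal $\nu$. A domain is an open subset $D\subseteq M$, not necessarily connected; it may contain points of $\partial M$. Let $\partial D$ be its topological boundary in $M$, and put $$\partial_0D=\partial D\cap\operatorname{int}M,\qquad \partial_1D=D\cap\partial M .$$ A function $u\in W^{1,2}_{loc}(D)$ (that is, $u$ and its weak gradient $\nabla u$ are square integrable on every compact subset of $D$; such a subset may meet $\partial M$) is a weak Neumann subsolution on $D$, i.e. it satisfies $\Delta u\ge 0$ on $D$ and $\partial u/\partial\nu\le 0$ on $\partial_1D$ in the weak Neumann sense, if $$-\int_D\langle\nabla u,\nabla\varphi\rangle\ \ge 0\qquad\text{for every } 0\le\varphi\in C_c^\infty(D).$$ $M$ is called (Neumann-)parabolic if every bounded above $u\in C^0(M)\cap W^{1,2}_{loc}(M)$ that is a weak Neumann subsolution on $M$ is constant. **Theorem (Ahlfors maximum principle).** $M$ is parabolic if and only if the following maximum principle holds: for every domain $D\subseteq M$ with $\partial_0D\neq\emptyset$ and $\partial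 D\cap\partial M\subseteq\overline{\partial_0D}$, and for every $u\in C^0(\overline D)\cap W^{1,2}_{loc}(D)$ that is a weak Neumann subsolution on $D$ with $\sup_Du<+\infty$, $$\sup_Du=\sup_{\partial_0D}u .$$ -/

import Mathlib

open MeasureTheory Set Function
open scoped Manifold ContDiff ENNReal

noncomputable section

/-- The model space `ℝⁿ` with its Euclidean norm and Lebesgue measure. -/
abbrev Euc (n : ℕ) : Type := EuclideanSpace ℝ (Fin n)

/-- Smooth Riemannian metrics on a manifold with boundary `M` of dimension `n`, modelled on the
Euclidean half-space. -/
abbrev SmoothMetric (n : ℕ) [NeZero n] (M : Type*) [TopologicalSpace M]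
    [ChartedSpace (EuclideanHalfSpace n) M] [IsManifold (𝓡∂ n) ∞ M] : Type _ :=
  Bundle.ContMDiffRiemannianMetric (𝓡∂ n) ∞ (Euc n) (fun x : M ↦ TangentSpace (𝓡∂ n) x)

namespace NeumannParabolic

/-- `w` is the weak derivative of `f` in the direction `v` on the open set `Ω ⊆ ℝⁿ`. -/
def HasWeakDirDeriv {n : ℕ} (Ω : Set (Euc n)) (f w : Euc n → ℝ) (v : Euc n) : Prop :=
  ∀ ψ : Euc n → ℝ, ContDiff ℝ ∞ ψ → HasCompactSupport ψ → tsupport ψ ⊆ Ω →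
    ∫ y, f y * fderiv ℝ ψ y v = -∫ y, w y * ψ y

/-- `h ∈ L²_loc(S)`: `h` is square integrable on every compact subset of `S ⊆ ℝⁿ`. -/
def MemL2Loc {n : ℕ} (S : Set (Euc n)) (h : Euc n → ℝ) : Prop :=
  ∀ K : Set (Euc n), IsCompact K → K ⊆ S → MemLp h 2 (volume.restrict K)

section Manifold

variable {n : ℕ} [NeZero n] {M : Type*} [TopologicalSpace M]
  [ChartedSpace (EuclideanHalfSpace n) M]

/-- `∂₀D = ∂D ∩ int M`, where `∂D` is the topological boundary of `D` in `M`. -/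
def boundaryZero (n : ℕ) [NeZero n] {M : Type*} [TopologicalSpace M]
    [ChartedSpace (EuclideanHalfSpace n) M] (D : Set M) : Set M :=
  frontier D ∩ (𝓡∂ n).interior M

/-- The coordinate vector field `∂ᵢ` of the chart around `x`, at the point of `M` with
coordinates `y`. -/
def coordField (x : M) (y : Euc n) (i : Fin n) :
    TangentSpace (𝓡∂ n) ((extChartAt (𝓡∂ n) x).symm y) :=
  mfderivWithin 𝓘(ℝ, Euc n) (𝓡∂ n) (extChartAt (𝓡∂ n) x).symm (range (𝓡∂ n)) y
    (EuclideanSpace.single i (1 : ℝ))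

variable [IsManifold (𝓡∂ n) ∞ M]

/-- The matrix `g_{ij} = g(∂ᵢ, ∂ⱼ)` of the metric in the chart around `x`. -/
def gram (g : SmoothMetric n M) (x : M) (y : Euc n) : Matrix (Fin n) (Fin n) ℝ :=
  Matrix.of fun i j ↦
    g.inner ((extChartAt (𝓡∂ n) x).symm y) (coordField x y i) (coordField x y j)

/-- The measure `√det(g_{ij}) dy` of the chart around `x`, transported to `M`
(it is concentrated on the domain of the chart). -/
def chartVolume [MeasurableSpace M] (g : SmoothMetric n M) (x : M) : Measure M :=
  ((volume.restrict (extChartAt (𝓡∂ n) x).target).withDensity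
    (fun y ↦ ENNReal.ofReal (Real.sqrt (gram g x y).det))).map (extChartAt (𝓡∂ n) x).symm

/-- The Riemannian volume measure: the least measure that dominates all the chart measures.
Since the chart measures agree on the overlaps of the chart domains, it restricts to
`√det(g_{ij}) dy` on the domain of each chart. -/
def riemannianVolume [MeasurableSpace M] (g : SmoothMetric n M) : Measure M :=
  ⨆ x : M, chartVolume g x

/-- The gradient `∇φ(p)`: the tangent vector with `g(∇φ(p), v) = dφ_p(v)` for all `v`
(see `inner_gradient`). -/
def gradient (g : SmoothMetric n M) (φ : M → ℝ) (p : M) : TangentSpace (𝓡∂ n) p :=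
  ContinuousLinearMap.inverse (g.inner p) (mfderiv (𝓡∂ n) 𝓘(ℝ, ℝ) φ p)

theorem inner_gradient (g : SmoothMetric n M) (φ : M → ℝ) (p : M) (v : TangentSpace (𝓡∂ n) p) :
    g.inner p (gradient g φ p) v = mfderiv (𝓡∂ n) 𝓘(ℝ, ℝ) φ p v := by
  have key : ∀ B : Euc n →L[ℝ] Euc n →L[ℝ] ℝ, (∀ v, v ≠ 0 → 0 < B v v) →
      ∀ l : Euc n →L[ℝ] ℝ, B (B.inverse l) = l := by
    intro B hB l
    have hinj : Injective (B : Euc n →ₗ[ℝ] Euc n →L[ℝ] ℝ) := by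
      rw [← LinearMap.ker_eq_bot, LinearMap.ker_eq_bot']
      intro v hv
      by_contra hne
      have h1 := hB v hne
      have h2 : B v = 0 := hv
      simp [h2] at h1
    have hdim : Module.finrank ℝ (Euc n) = Module.finrank ℝ (Euc n →L[ℝ] ℝ) :=
      (InnerProductSpace.toDual ℝ (Euc n)).toLinearEquiv.finrank_eq
    let e : Euc n ≃L[ℝ] (Euc n →L[ℝ] ℝ) :=
      (LinearEquiv.ofInjectiveOfFinrankEq (B : Euc n →ₗ[ℝ] Euc n →L[ℝ] ℝ) hinj
        hdim).toContinuousLinearEquiv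
    have he : (e : Euc n →L[ℝ] Euc n →L[ℝ] ℝ) = B := by
      ext1 v
      rfl
    rw [← he, ContinuousLinearMap.inverse_equiv]
    simp
  exact congrArg (fun l : Euc n →L[ℝ] ℝ ↦ l v)
    (key (g.inner p) (fun v hv ↦ g.pos p v hv) (mfderiv (𝓡∂ n) 𝓘(ℝ, ℝ) φ p))

/-- `u ∈ W^{1,2}_loc(D)` with weak gradient the vector field `X`. In the chart around each point,
`u` and the components `g(X, ∂ᵢ)` belong to `L²_loc` of the coordinate image of `D` (up to the
points of `D ∩ ∂M`), and `g(X, ∂ᵢ)` is the weak `i`-th partial derivative of `u` in the interior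
of the coordinate image of `D`. -/
structure HasWeakGradient (g : SmoothMetric n M) (D : Set M) (u : M → ℝ)
    (X : (p : M) → TangentSpace (𝓡∂ n) p) : Prop where
  memL2Loc : ∀ x : M,
    MemL2Loc ((extChartAt (𝓡∂ n) x).target ∩ (extChartAt (𝓡∂ n) x).symm ⁻¹' D)
      (fun y ↦ u ((extChartAt (𝓡∂ n) x).symm y))
  memL2Loc_gradient : ∀ (x : M) (i : Fin n),
    MemL2Loc ((extChartAt (𝓡∂ n) x).target ∩ (extChartAt (𝓡∂ n) x).symm ⁻¹' D)
      (fun y ↦ g.inner ((extChartAt (𝓡∂ n) x).symm y) (X ((extChartAt (𝓡∂ n) x).symm y))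
        (coordField x y i))
  weakDeriv : ∀ (x : M) (i : Fin n),
    HasWeakDirDeriv
      (interior ((extChartAt (𝓡∂ n) x).target ∩ (extChartAt (𝓡∂ n) x).symm ⁻¹' D))
      (fun y ↦ u ((extChartAt (𝓡∂ n) x).symm y))
      (fun y ↦ g.inner ((extChartAt (𝓡∂ n) x).symm y) (X ((extChartAt (𝓡∂ n) x).symm y))
        (coordField x y i))
      (EuclideanSpace.single i (1 : ℝ))

/-- `u ∈ W^{1,2}_loc(D)` is a weak Neumann solution of `Δu ≥ 0` on `D`, `∂u/∂ν ≤ 0` on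
`∂₁D = D ∩ ∂M`: `-∫_D ⟨∇u, ∇φ⟩ ≥ 0` for all `0 ≤ φ ∈ C_c^∞(D)`. The support of `φ` is a compact
subset of `D`, which may meet `∂M`. -/
def IsWeakNeumannSubsolution [MeasurableSpace M] (g : SmoothMetric n M) (D : Set M)
    (u : M → ℝ) : Prop :=
  ∃ X : (p : M) → TangentSpace (𝓡∂ n) p, HasWeakGradient g D u X ∧
    ∀ φ : M → ℝ, ContMDiff (𝓡∂ n) 𝓘(ℝ, ℝ) ∞ φ → HasCompactSupport φ → tsupport φ ⊆ D →
      (∀ p, 0 ≤ φ p) →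
      0 ≤ -∫ p in D, g.inner p (X p) (gradient g φ p) ∂(riemannianVolume g)

/-- Neumann parabolicity: every bounded above `u ∈ C⁰(M) ∩ W^{1,2}_loc(M)` that is a weak Neumann
subsolution of the Laplace equation on `M` is constant. -/
def IsParabolic [MeasurableSpace M] (g : SmoothMetric n M) : Prop :=
  ∀ u : M → ℝ, Continuous u → IsWeakNeumannSubsolution g univ u → BddAbove (range u) →
    ∃ c : ℝ, ∀ p, u p = c

end Manifold

end NeumannParabolic

end

/-!
The maximum principle implies parabolicity by applying it to the domains `M \ {p}`, where `p` is an
interior point: then `∂₀D = {p}`, so every interior point is a maximum point of every bounded above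
subsolution, and the interior is dense (`isParabolic_of_maximumPrinciple`).

Conversely, let `M` be parabolic and suppose that `sup_{∂₀D} u < γ < sup_D u`. The set
`C = {p ∈ closure D | γ ≤ u p}` is contained in `D`, because a point of `∂D` lies in `∂₀D` or in the
closure of `∂₀D`. Let `H` be a smooth convex function that vanishes on `(-∞, γ]` and is positive
and increasing beyond `γ`. Then `H ∘ u`, extended by zero outside `D`, is continuous and bounded
above, and it is a weak Neumann subsolution on `M`. By parabolicity it is constant; it vanishes on
`∂₀D` and is positive somewhere, a contradiction (`IsParabolic.sSup_image_eq`).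

The analytic content is that `H ∘ u` is a weak subsolution with weak gradient `η(u) ∇u`, where
`η = H'` (`IsWeakNeumannSubsolution.comp_extend`). Formally, testing the inequality for `u` with
`φ η(u)` gives `∫ η(u) ⟨∇u, ∇φ⟩ ≤ -∫ φ η'(u) |∇u|² ≤ 0`. Only smooth test functions are admissible,
so a partition of unity reduces the claim to test functions supported in a chart
(`integral_inner_gradient_nonpos_of_local`), and there `u` is replaced by mollifications `u_k`. The
kernels are supported on the side of the origin that makes `u_k(y)` an average of `u` over small
balls in the open half-space, even for `y` on the boundary; hence `∂ᵢu_k` is the mollification of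
the weak derivative up to the boundary (`exists_smooth_approx`), and no extension of `u` is needed.
The passage to the limit uses that `u_k → u` uniformly, by continuity of `u`, and that `∂ᵢu_k → ∂ᵢu`
when paired with `L²` functions, by continuity of translations in `L²`
(`setIntegral_comp_mul_nonpos`). The same approximation gives the chain rule
(`HasWeakDirDeriv.comp`).

Integrals over `M` are computed in charts. The chart measures `√det(g_{ij}) dy` agree on overlaps by
the change of variables formula, so the Riemannian volume restricts to each of them
(`riemannianVolume_restrict_source`), and `⟨Y, ∇φ⟩` becomes a pairing of the components of `Y` with
the partial derivatives of `φ` (`integral_inner_gradient_eq`).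
-/

namespace NeumannParabolic

open Filter Topology Metric
open scoped Convolution

/-! ### Mollification of functions with weak derivatives -/

/-- Continuity of translations in `L²(ℝⁿ)`. -/
theorem tendsto_eLpNorm_translate_sub {n : ℕ} {G : Euc n → ℝ} (hG : MemLp G 2 volume) :
    Tendsto (fun z ↦ eLpNorm (fun y ↦ G (y - z) - G y) 2 volume) (𝓝 0) (𝓝 0) := by
  let τ : Euc n → C(Euc n, Euc n) := fun z ↦ ⟨fun y ↦ y - z, by fun_prop⟩
  have hτ : Continuous τ :=
    ContinuousMap.continuous_of_continuous_uncurry _ (by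
      change Continuous fun p : Euc n × Euc n ↦ p.2 - p.1
      fun_prop)
  have hmp : ∀ z, MeasurePreserving (τ z) (volume : Measure (Euc n)) volume := fun z ↦
    measurePreserving_sub_right volume z
  have key : Tendsto (fun z ↦ Lp.compMeasurePreserving (τ z) (hmp z) hG.toLp) (𝓝 0)
      (𝓝 (Lp.compMeasurePreserving (τ 0) (hmp 0) hG.toLp)) :=
    Filter.Tendsto.compMeasurePreservingLp tendsto_const_nhds hτ.continuousAt hmp (hmp 0)
      (by simp)
  rw [tendsto_iff_edist_tendsto_0] at key
  refine key.congr fun z ↦ ?_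
  rw [Lp.edist_def]
  refine eLpNorm_congr_ae ?_
  have h1 : ∀ z, Lp.compMeasurePreserving (τ z) (hmp z) hG.toLp =ᵐ[volume] fun y ↦ G (y - z) :=
    fun z ↦ (Lp.coeFn_compMeasurePreserving _ (hmp z)).trans
      ((hmp z).quasiMeasurePreserving.ae_eq_comp hG.coeFn_toLp)
  filter_upwards [h1 z, h1 0] with y hy hy0
  rw [Pi.sub_apply, hy, hy0, sub_zero]

/-- Averages of small translates of `G ∈ L²` converge to `G`, tested against an `L²` function. -/
theorem lintegral_mul_average_sub_le {n : ℕ} {F G ρ : Euc n → ℝ} (hF : MemLp F 2 volume)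
    (hG : MemLp G 2 volume) (hρ : Continuous ρ) (hρc : HasCompactSupport ρ)
    (hρ0 : ∀ z, 0 ≤ ρ z) (hρ1 : ∫ z, ρ z = 1) {ε : ℝ≥0∞}
    (hε : ∀ z ∈ support ρ, eLpNorm (fun y ↦ G (y - z) - G y) 2 volume ≤ ε) :
    ∫⁻ y, ‖F y‖ₑ * ‖(∫ z, ρ z * G (y - z)) - G y‖ₑ ≤ eLpNorm F 2 volume * ε := by
  have hρi : Integrable ρ := hρ.integrable_of_hasCompactSupport hρc
  have hGm : AEStronglyMeasurable (fun p : Euc n × Euc n ↦ G (p.1 - p.2))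
      (volume.prod volume) :=
    hG.1.comp_quasiMeasurePreserving (quasiMeasurePreserving_sub volume volume)
  have hGl : LocallyIntegrable G volume := hG.locallyIntegrable (by norm_num)
  have hconv : ∀ y, Integrable fun z ↦ ρ z * G (y - z) := fun y ↦
    hρc.convolutionExists_left (ContinuousLinearMap.mul ℝ ℝ) hρ hGl y
  have step1 : ∀ y, ‖(∫ z, ρ z * G (y - z)) - G y‖ₑ ≤ ∫⁻ z, ‖ρ z‖ₑ * ‖G (y - z) - G y‖ₑ := by
    intro y
    have : (∫ z, ρ z * G (y - z)) - G y = ∫ z, ρ z * (G (y - z) - G y) := by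
      simp_rw [mul_sub]
      rw [integral_sub (hconv y) (hρi.mul_const _), integral_mul_const, hρ1, one_mul]
    rw [this]
    refine (enorm_integral_le_lintegral_enorm _).trans (le_of_eq ?_)
    simp_rw [enorm_mul]
  have hm : AEMeasurable (uncurry fun y z : Euc n ↦ ‖F y‖ₑ * (‖ρ z‖ₑ * ‖G (y - z) - G y‖ₑ))
      (volume.prod volume) := by
    refine AEMeasurable.mul (hF.1.comp_fst (ν := volume)).enorm
      (AEMeasurable.mul ?_ (hGm.sub (hG.1.comp_fst (ν := volume))).enorm)
    exact (hρ.comp continuous_snd).aestronglyMeasurable.enorm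
  calc ∫⁻ y, ‖F y‖ₑ * ‖(∫ z, ρ z * G (y - z)) - G y‖ₑ
      ≤ ∫⁻ y, ∫⁻ z, ‖F y‖ₑ * (‖ρ z‖ₑ * ‖G (y - z) - G y‖ₑ) := by
        refine lintegral_mono fun y ↦ ?_
        rw [lintegral_const_mul' _ _ enorm_ne_top]
        gcongr
        exact step1 y
    _ = ∫⁻ z, ∫⁻ y, ‖F y‖ₑ * (‖ρ z‖ₑ * ‖G (y - z) - G y‖ₑ) := lintegral_lintegral_swap hm
    _ = ∫⁻ z, ‖ρ z‖ₑ * ∫⁻ y, ‖F y‖ₑ * ‖G (y - z) - G y‖ₑ := by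
        congr 1 with z
        rw [← lintegral_const_mul' _ _ enorm_ne_top]
        congr 1 with y
        ring
    _ ≤ ∫⁻ z, ‖ρ z‖ₑ * (eLpNorm F 2 volume * ε) := by
        refine lintegral_mono fun z ↦ ?_
        by_cases hz : z ∈ support ρ
        · gcongr
          have hT : AEStronglyMeasurable (fun y ↦ G (y - z) - G y) volume :=
            (hG.1.comp_measurePreserving (measurePreserving_sub_right volume z)).sub hG.1
          have := eLpNorm_smul_le_mul_eLpNorm (p := 2) (q := 2) (r := 1) hT hF.1
          rw [eLpNorm_one_eq_lintegral_enorm] at this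
          simp only [Pi.smul_apply', smul_eq_mul, enorm_mul] at this
          refine this.trans ?_
          gcongr
          exact hε z hz
        · simp [notMem_support.1 hz]
    _ = eLpNorm F 2 volume * ε := by
        have : ∫⁻ z, ‖ρ z‖ₑ = 1 := by
          rw [lintegral_congr fun z ↦ (Real.enorm_of_nonneg (hρ0 z)),
            ← ofReal_integral_eq_lintegral_ofReal hρi (.of_forall hρ0), hρ1, ENNReal.ofReal_one]
        rw [lintegral_mul_const'' _ hρ.aestronglyMeasurable.enorm, this, one_mul]

/-- The derivative of the mollification of `u` at a point `y` near which `u` has the weak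
derivative `w` is the mollification of `w`. -/
theorem fderiv_mollification {n : ℕ} {K₁ : Set (Euc n)} (hK₁ : IsCompact K₁) {u w ρ : Euc n → ℝ}
    {e : Euc n} (hu : ContinuousOn u K₁) (hd : HasWeakDirDeriv (interior K₁) u w e)
    (hρ : ContDiff ℝ ∞ ρ) (hρc : HasCompactSupport ρ) {y : Euc n}
    (hy : ∀ z ∈ tsupport ρ, y - z ∈ interior K₁) :
    fderiv ℝ (fun y ↦ ∫ z, ρ z * K₁.indicator u (y - z)) y e
      = ∫ z, ρ z * K₁.indicator w (y - z) := by
  have hui : Integrable (K₁.indicator u) :=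
    (integrable_indicator_iff hK₁.measurableSet).2 (hu.integrableOn_compact hK₁)
  have hcomm : ∀ (f : Euc n → ℝ) (y : Euc n),
      ∫ z, ρ z * f (y - z) = ∫ x, f x * ρ (y - x) := by
    intro f y
    rw [← integral_sub_left_eq_self (fun x ↦ f x * ρ (y - x)) volume y]
    simp [mul_comm]
  simp_rw [hcomm]
  have h1 := hρc.hasFDerivAt_convolution_right (ContinuousLinearMap.mul ℝ ℝ) (μ := volume)
    hui.locallyIntegrable (hρ.of_le (by simp)) y
  have h2 : HasFDerivAt (fun y ↦ ∫ x, K₁.indicator u x * ρ (y - x)) _ y := h1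
  rw [h2.fderiv]
  have hex := hρc.fderiv (𝕜 := ℝ) |>.convolutionExists_right
    ((ContinuousLinearMap.mul ℝ ℝ).precompR (Euc n)) (μ := volume)
    hui.locallyIntegrable (hρ.continuous_fderiv (by simp)) y
  have h3 : ((K₁.indicator u) ⋆[(ContinuousLinearMap.mul ℝ ℝ).precompR (Euc n), volume]
      fderiv ℝ ρ) y e = ∫ x, K₁.indicator u x * fderiv ℝ ρ (y - x) e := by
    rw [convolution_def, ContinuousLinearMap.integral_apply hex]
    simp
  rw [h3]
  -- the test function `x ↦ ρ (y - x)`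
  have hψd : ∀ x, fderiv ℝ (fun x ↦ ρ (y - x)) x e = -fderiv ℝ ρ (y - x) e := by
    intro x
    have hρx : HasFDerivAt ρ (fderiv ℝ ρ (y - x)) (y - x) :=
      (hρ.differentiable (by simp) _).hasFDerivAt
    have := (hρx.comp x ((hasFDerivAt_id x).const_sub y)).fderiv
    simp only [Function.comp_def] at this
    rw [this]
    simp
  have hψt : tsupport (fun x ↦ ρ (y - x)) ⊆ interior K₁ := by
    have : tsupport (fun x ↦ ρ (y - x)) ⊆ (fun x ↦ y - x) ⁻¹' tsupport ρ := by
      refine closure_minimal (fun x hx ↦ ?_) ((isClosed_tsupport ρ).preimage (by fun_prop))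
      exact subset_tsupport ρ hx
    intro x hx
    have := hy _ (this hx)
    simpa using this
  have hψc : HasCompactSupport (fun x ↦ ρ (y - x)) :=
    hρc.comp_homeomorph (Homeomorph.subLeft y)
  have h4 := hd (fun x ↦ ρ (y - x)) (hρ.comp (contDiff_const.sub contDiff_id)) hψc hψt
  simp_rw [hψd] at h4
  simp only [mul_neg, integral_neg, neg_inj] at h4
  have hsupp : ∀ x, ρ (y - x) ≠ 0 → x ∈ K₁ := fun x hx ↦
    interior_subset (hψt (subset_tsupport _ hx))
  have hsupp' : ∀ x, fderiv ℝ ρ (y - x) e ≠ 0 → x ∈ K₁ := by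
    intro x hx
    have h6 : y - x ∈ tsupport ρ := by
      refine support_fderiv_subset ℝ (f := ρ) (fun h0 ↦ hx ?_)
      rw [h0]; rfl
    simpa using interior_subset (hy _ h6)
  calc ∫ x, K₁.indicator u x * fderiv ℝ ρ (y - x) e = ∫ x, u x * fderiv ℝ ρ (y - x) e := by
        congr 1 with x
        by_cases hx : x ∈ K₁
        · simp [hx]
        · simp [not_imp_comm.1 (hsupp' x) hx]
    _ = ∫ x, w x * ρ (y - x) := h4
    _ = ∫ x, K₁.indicator w x * ρ (y - x) := by
        congr 1 with x
        by_cases hx : x ∈ K₁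
        · simp [hx]
        · simp [not_imp_comm.1 (hsupp x) hx]

/-- Local smooth approximation of a continuous function with weak derivatives in `L²`. The
approximations are averages over the balls of radius `t / 2` around the points `y + t • v`; only
these balls have to lie in the interior of `K₁`, so that `K` may touch the boundary of `K₁` as
long as the direction `v` points inwards. -/
theorem exists_smooth_approx {n : ℕ} {ι : Type*} {K K₁ : Set (Euc n)}
    (hK : IsCompact K) (hK₁ : IsCompact K₁) (hKK : K ⊆ K₁) {v : Euc n} {δ : ℝ} (hδ : 0 < δ)
    (hKv : ∀ t, 0 < t → t < δ → ∀ y ∈ K, closedBall (y + t • v) (t / 2) ⊆ interior K₁)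
    {u : Euc n → ℝ} (hu : ContinuousOn u K₁) {w : ι → Euc n → ℝ} {e : ι → Euc n}
    (hw : ∀ i, MemLp (w i) 2 (volume.restrict K₁))
    (hd : ∀ i, HasWeakDirDeriv (interior K₁) u (w i) (e i)) :
    ∃ f : ℕ → Euc n → ℝ, (∀ k, ContDiff ℝ ∞ (f k)) ∧ TendstoUniformlyOn f u atTop K ∧
      ∀ (i : ι) (F : Euc n → ℝ), MemLp F 2 (volume.restrict K) →
        Tendsto (fun k ↦ ∫⁻ y in K, ‖F y‖ₑ * ‖fderiv ℝ (f k) y (e i) - w i y‖ₑ) atTop (𝓝 0) := by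
  obtain ⟨t, -, ht, htlim⟩ := exists_seq_strictAnti_tendsto' hδ
  have ht0 : ∀ k, 0 < t k := fun k ↦ (ht k).1
  let b : ∀ k, ContDiffBump (-(t k • v)) := fun k ↦ ⟨t k / 4, t k / 2, by linarith [ht0 k], by
    linarith [ht0 k]⟩
  let ρ : ℕ → Euc n → ℝ := fun k ↦ (b k).normed volume
  have hρ : ∀ k, ContDiff ℝ ∞ (ρ k) := fun k ↦ (b k).contDiff_normed
  have hρc : ∀ k, HasCompactSupport (ρ k) := fun k ↦ (b k).hasCompactSupport_normed
  have hρ0 : ∀ k z, 0 ≤ ρ k z := fun k z ↦ (b k).nonneg_normed z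
  have hρ1 : ∀ k, ∫ z, ρ k z = 1 := fun k ↦ (b k).integral_normed
  have hρi : ∀ k, Integrable (ρ k) := fun k ↦ (b k).integrable_normed
  have hts : ∀ k, tsupport (ρ k) = closedBall (-(t k • v)) (t k / 2) := fun k ↦
    (b k).tsupport_normed_eq
  -- the supports of the kernels shrink to the origin
  have hsmall : ∀ r > 0, ∀ᶠ k in atTop, ∀ z ∈ tsupport (ρ k), ‖z‖ < r := by
    intro r hr
    have h0 : Tendsto (fun k ↦ t k * (‖v‖ + 1)) atTop (𝓝 0) := by
      simpa using htlim.mul_const (‖v‖ + 1)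
    filter_upwards [h0.eventually_lt_const hr] with k hk z hz
    rw [hts, mem_closedBall, dist_eq_norm, sub_neg_eq_add] at hz
    have h1 : ‖z‖ ≤ ‖z + t k • v‖ + ‖t k • v‖ := by
      simpa using norm_sub_le (z + t k • v) (t k • v)
    rw [norm_smul, Real.norm_of_nonneg (ht0 k).le] at h1
    nlinarith [ht0 k]
  have hmem : ∀ k, ∀ y ∈ K, ∀ z ∈ tsupport (ρ k), y - z ∈ interior K₁ := by
    intro k y hy z hz
    refine hKv _ (ht k).1 (ht k).2 y hy ?_
    rw [hts, mem_closedBall, dist_eq_norm, sub_neg_eq_add] at hz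
    rw [mem_closedBall, dist_eq_norm, ← norm_neg]
    have h1 : -(y - z - (y + t k • v)) = z + t k • v := by abel
    rwa [h1]
  have hui : Integrable (K₁.indicator u) :=
    (integrable_indicator_iff hK₁.measurableSet).2 (hu.integrableOn_compact hK₁)
  refine ⟨fun k y ↦ ∫ z, ρ k z * K₁.indicator u (y - z), fun k ↦ ?_, ?_, ?_⟩
  · exact (hρc k).contDiff_convolution_left (ContinuousLinearMap.mul ℝ ℝ) (μ := volume) (hρ k)
      hui.locallyIntegrable
  · rw [Metric.tendstoUniformlyOn_iff]
    intro ε hε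
    have huc := Metric.uniformContinuousOn_iff.1 (hK₁.uniformContinuousOn_of_continuous hu)
    obtain ⟨r, hr, hru⟩ := huc (ε / 2) (half_pos hε)
    filter_upwards [hsmall r hr] with k hk y hy
    have hconv : Integrable fun z ↦ ρ k z * K₁.indicator u (y - z) :=
      (hρc k).convolutionExists_left (ContinuousLinearMap.mul ℝ ℝ) (hρ k).continuous
        hui.locallyIntegrable y
    have h1 : (∫ z, ρ k z * K₁.indicator u (y - z)) - u y
        = ∫ z, ρ k z * (K₁.indicator u (y - z) - u y) := by
      simp_rw [mul_sub]
      rw [integral_sub hconv ((hρi k).mul_const _), integral_mul_const, hρ1, one_mul]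
    rw [dist_comm, Real.dist_eq, h1]
    have h2 : ‖∫ z, ρ k z * (K₁.indicator u (y - z) - u y)‖ ≤ ∫ z, ρ k z * (ε / 2) := by
      refine norm_integral_le_of_norm_le ((hρi k).mul_const _) (.of_forall fun z ↦ ?_)
      rw [norm_mul, Real.norm_of_nonneg (hρ0 k z)]
      by_cases hz : z ∈ tsupport (ρ k)
      · have hz1 := interior_subset (hmem k y hy z hz)
        refine mul_le_mul_of_nonneg_left ?_ (hρ0 k z)
        rw [indicator_of_mem hz1, ← dist_eq_norm]
        refine (hru _ hz1 _ (hKK hy) ?_).le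
        rw [dist_eq_norm]
        simpa using hk z hz
      · simp [image_eq_zero_of_notMem_tsupport hz]
    rw [integral_mul_const, hρ1, one_mul] at h2
    exact h2.trans_lt (half_lt_self hε)
  · intro i F hF
    have hG : MemLp (K₁.indicator (w i)) 2 volume :=
      (memLp_indicator_iff_restrict hK₁.measurableSet).2 (hw i)
    have hF' : MemLp (K.indicator F) 2 volume :=
      (memLp_indicator_iff_restrict hK.measurableSet).2 hF
    have heq : ∀ k, ∫⁻ y in K, ‖F y‖ₑ *
        ‖fderiv ℝ (fun y ↦ ∫ z, ρ k z * K₁.indicator u (y - z)) y (e i) - w i y‖ₑ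
        = ∫⁻ y, ‖K.indicator F y‖ₑ *
          ‖(∫ z, ρ k z * K₁.indicator (w i) (y - z)) - K₁.indicator (w i) y‖ₑ := by
      intro k
      rw [← lintegral_indicator hK.measurableSet]
      congr 1 with y
      by_cases hy : y ∈ K
      · rw [indicator_of_mem hy, indicator_of_mem hy, indicator_of_mem (hKK hy),
          fderiv_mollification hK₁ hu (hd i) (hρ k) (hρc k) (hmem k y hy)]
      · simp [hy]
    simp_rw [heq]
    rw [ENNReal.tendsto_nhds_zero]
    intro ε hε
    -- it suffices that translation by the support of the kernel moves `w` by at most `c` in `L²`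
    obtain ⟨c, hc, hcε⟩ : ∃ c : ℝ≥0∞, 0 < c ∧ eLpNorm (K.indicator F) 2 volume * c ≤ ε := by
      have h0 : Tendsto (fun c : ℝ≥0∞ ↦ eLpNorm (K.indicator F) 2 volume * c) (𝓝[>] 0) (𝓝 0) := by
        have := ENNReal.Tendsto.const_mul (a := eLpNorm (K.indicator F) 2 volume)
          (tendsto_id (x := 𝓝 (0 : ℝ≥0∞))) (Or.inr hF'.eLpNorm_ne_top)
        simp only [mul_zero, id] at this
        exact this.mono_left nhdsWithin_le_nhds
      obtain ⟨c, hc1, hc2⟩ := ((ENNReal.tendsto_nhds_zero.1 h0 ε hε).and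
        self_mem_nhdsWithin).exists
      exact ⟨c, hc2, hc1⟩
    obtain ⟨r, hr, hrc⟩ := Metric.eventually_nhds_iff.1
      (ENNReal.tendsto_nhds_zero.1 (tendsto_eLpNorm_translate_sub hG) c hc)
    filter_upwards [hsmall r hr] with k hk
    refine (lintegral_mul_average_sub_le hF' hG (hρ k).continuous (hρc k) (hρ0 k) (hρ1 k)
      fun z hz ↦ hrc ?_).trans hcε
    simpa using hk z (subset_tsupport _ hz)

/-- Postcomposition with a continuous function preserves uniform convergence on a compact set to a
continuous function. -/
theorem tendstoUniformlyOn_comp_of_isCompact {X : Type*} [TopologicalSpace X] {K : Set X}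
    (hK : IsCompact K) {f : ℕ → X → ℝ} {u : X → ℝ} (hf : TendstoUniformlyOn f u atTop K)
    (hu : ContinuousOn u K) {η : ℝ → ℝ} (hη : Continuous η) :
    TendstoUniformlyOn (fun k ↦ η ∘ f k) (η ∘ u) atTop K := by
  have hc : IsCompact (cthickening 1 (u '' K)) := (hK.image_of_continuousOn hu).cthickening
  refine UniformContinuousOn.comp_tendstoUniformlyOn_eventually (s := cthickening 1 (u '' K))
    ?_ (fun x hx ↦ self_subset_cthickening _ (mem_image_of_mem u hx))
    (hc.uniformContinuousOn_of_continuous hη.continuousOn) hf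
  filter_upwards [Metric.tendstoUniformlyOn_iff.1 hf 1 one_pos] with k hk x hx
  refine mem_cthickening_of_dist_le _ (u x) _ _ (mem_image_of_mem u hx) ?_
  rw [dist_comm]
  exact (hk x hx).le

theorem tendsto_setIntegral_mul_of_tendstoUniformlyOn {n : ℕ} {K : Set (Euc n)}
    (hK : IsCompact K) {g : ℕ → Euc n → ℝ} {h P : Euc n → ℝ}
    (hg : TendstoUniformlyOn g h atTop K) (hgc : ∀ k, ContinuousOn (g k) K)
    (hP : IntegrableOn P K) :
    Tendsto (fun k ↦ ∫ y in K, g k y * P y) atTop (𝓝 (∫ y in K, h y * P y)) := by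
  have hh : ContinuousOn h K := hg.continuousOn (Frequently.of_forall hgc)
  have hi : ∀ k, IntegrableOn (fun y ↦ g k y * P y) K := fun k ↦
    hP.continuousOn_mul (hgc k) hK
  have hi' : IntegrableOn (fun y ↦ h y * P y) K := hP.continuousOn_mul hh hK
  rw [Metric.tendsto_nhds]
  intro ε hε
  have hc : 0 < (∫ y in K, |P y|) + 1 := by
    have := integral_nonneg (μ := volume.restrict K) (f := fun y ↦ |P y|) fun y ↦ abs_nonneg _
    linarith
  filter_upwards [Metric.tendstoUniformlyOn_iff.1 hg (ε / ((∫ y in K, |P y|) + 1)) (by positivity)]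
    with k hk
  rw [Real.dist_eq, ← integral_sub (hi k) hi']
  have h1 : ‖∫ y in K, (g k y * P y - h y * P y)‖
      ≤ ∫ y in K, ε / ((∫ y in K, |P y|) + 1) * |P y| := by
    refine norm_integral_le_of_norm_le (hP.abs.const_mul _) ?_
    filter_upwards [ae_restrict_mem hK.measurableSet] with y hy
    rw [← sub_mul, norm_mul, Real.norm_eq_abs (P y)]
    refine mul_le_mul_of_nonneg_right ?_ (abs_nonneg _)
    rw [← dist_eq_norm, dist_comm]
    exact (hk y hy).le
  rw [integral_const_mul] at h1
  refine h1.trans_lt ?_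
  rw [div_mul_eq_mul_div, div_lt_iff₀ hc]
  linarith

theorem tendsto_setIntegral_mul_mul {n : ℕ} {K : Set (Euc n)}
    (hK : IsCompact K) {g d : ℕ → Euc n → ℝ} {h w F : Euc n → ℝ}
    (hg : TendstoUniformlyOn g h atTop K) (hgc : ∀ k, ContinuousOn (g k) K)
    (hF : MemLp F 2 (volume.restrict K)) (hw : MemLp w 2 (volume.restrict K))
    (hdc : ∀ k, ContinuousOn (d k) K)
    (hd : Tendsto (fun k ↦ ∫⁻ y in K, ‖F y‖ₑ * ‖d k y - w y‖ₑ) atTop (𝓝 0)) :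
    Tendsto (fun k ↦ ∫ y in K, g k y * (F y * d k y)) atTop (𝓝 (∫ y in K, h y * (F y * w y))) := by
  have hh : ContinuousOn h K := hg.continuousOn (Frequently.of_forall hgc)
  have hFi : IntegrableOn F K := by
    have : IsFiniteMeasure (volume.restrict K) := ⟨by simpa using hK.measure_lt_top⟩
    exact hF.integrable (by norm_num)
  have hFw : IntegrableOn (fun y ↦ F y * w y) K := hF.integrable_mul hw
  have hFd : ∀ k, IntegrableOn (fun y ↦ F y * d k y) K := fun k ↦ hFi.mul_continuousOn (hdc k) hK
  have h1 := tendsto_setIntegral_mul_of_tendstoUniformlyOn hK hg hgc hFw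
  obtain ⟨C, hC⟩ := hK.exists_bound_of_continuousOn hh
  have h2 : Tendsto (fun k ↦ (∫ y in K, g k y * (F y * d k y)) - ∫ y in K, g k y * (F y * w y))
      atTop (𝓝 0) := by
    have h3 : Tendsto (fun k ↦ ENNReal.ofReal (C + 1) * ∫⁻ y in K, ‖F y‖ₑ * ‖d k y - w y‖ₑ) atTop
        (𝓝 0) := by
      simpa using ENNReal.Tendsto.const_mul hd (Or.inr ENNReal.ofReal_ne_top)
    rw [tendsto_zero_iff_enorm_tendsto_zero]
    refine tendsto_of_tendsto_of_tendsto_of_le_of_le' tendsto_const_nhds h3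
      (.of_forall fun _ ↦ zero_le) ?_
    filter_upwards [Metric.tendstoUniformlyOn_iff.1 hg 1 one_pos] with k hk
    rw [← integral_sub ((hFd k).continuousOn_mul (hgc k) hK) (hFw.continuousOn_mul (hgc k) hK)]
    refine (enorm_integral_le_lintegral_enorm _).trans ?_
    rw [← lintegral_const_mul' _ _ ENNReal.ofReal_ne_top]
    refine setLIntegral_mono_ae' hK.measurableSet (.of_forall fun y hy ↦ ?_)
    rw [← mul_sub, ← mul_sub, enorm_mul, enorm_mul]
    gcongr
    rw [← ofReal_norm]
    refine ENNReal.ofReal_le_ofReal ?_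
    have := hk y hy
    rw [dist_comm, dist_eq_norm] at this
    have h4 := norm_add_le (g k y - h y) (h y)
    rw [sub_add_cancel] at h4
    linarith [hC y hy]
  simpa using h2.add h1

theorem HasWeakDirDeriv.mono {n : ℕ} {Ω Ω' : Set (Euc n)} {u w : Euc n → ℝ} {e : Euc n}
    (h : HasWeakDirDeriv Ω u w e) (hΩ : Ω' ⊆ Ω) : HasWeakDirDeriv Ω' u w e :=
  fun ψ h1 h2 h3 ↦ h ψ h1 h2 (h3.trans hΩ)

theorem MemL2Loc.mono {n : ℕ} {S S' : Set (Euc n)} {h : Euc n → ℝ}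
    (hh : MemL2Loc S h) (hS : S' ⊆ S) : MemL2Loc S' h :=
  fun K h1 h2 ↦ hh K h1 (h2.trans hS)

theorem memLp_of_continuousOn_isCompact {n : ℕ} {K : Set (Euc n)} (hK : IsCompact K)
    {f : Euc n → ℝ} (hf : ContinuousOn f K) {p : ℝ≥0∞} : MemLp f p (volume.restrict K) := by
  have : IsFiniteMeasure (volume.restrict K) := ⟨by simpa using hK.measure_lt_top⟩
  obtain ⟨C, hC⟩ := hK.exists_bound_of_continuousOn hf
  exact MemLp.of_bound (hf.aestronglyMeasurable hK.measurableSet) C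
    ((ae_restrict_mem hK.measurableSet).mono hC)

theorem memLp_continuousOn_mul {n : ℕ} {K : Set (Euc n)} (hK : IsCompact K)
    {f h : Euc n → ℝ} (hf : ContinuousOn f K) (hh : MemLp h 2 (volume.restrict K)) :
    MemLp (fun y ↦ f y * h y) 2 (volume.restrict K) := by
  exact hh.mul (memLp_of_continuousOn_isCompact hK hf (p := ∞)) (r := 2)

/-- The chain rule for weak derivatives of continuous functions. -/
theorem HasWeakDirDeriv.comp {n : ℕ} {Ω : Set (Euc n)} (hΩ : IsOpen Ω) {u w : Euc n → ℝ}
    {e : Euc n} (h : HasWeakDirDeriv Ω u w e) (hu : ContinuousOn u Ω) (hw : MemL2Loc Ω w)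
    {H η : ℝ → ℝ} (hH : ∀ s, HasDerivAt H (η s) s) (hη : Continuous η) :
    HasWeakDirDeriv Ω (fun y ↦ H (u y)) (fun y ↦ η (u y) * w y) e := by
  intro ψ hψ hψc hψΩ
  have hHc : Continuous H := continuous_iff_continuousAt.2 fun s ↦ (hH s).continuousAt
  set K := tsupport ψ with hKdef
  have hK : IsCompact K := hψc
  obtain ⟨r, hr, hrΩ⟩ := hK.exists_cthickening_subset_open hΩ hψΩ
  set K₁ := cthickening r K
  have hK₁ : IsCompact K₁ := hK.cthickening
  have hint : interior K₁ ⊆ Ω := interior_subset.trans hrΩ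
  obtain ⟨f, hf, hfu, hfw⟩ := exists_smooth_approx (ι := Unit) (w := fun _ ↦ w) (e := fun _ ↦ e)
    (v := 0) hK hK₁ (self_subset_cthickening K) hr (fun t ht htr y hy ↦ by
      rw [smul_zero, add_zero]
      refine Subset.trans (fun z hz ↦ ?_)
        (interior_maximal (thickening_subset_cthickening r K) isOpen_thickening)
      refine mem_thickening_iff.2 ⟨y, hy, ?_⟩
      linarith [mem_closedBall.1 hz])
    (hu.mono hrΩ) (fun _ ↦ hw K₁ hK₁ hrΩ) (fun _ ↦ h.mono hint)
  have huK : ContinuousOn u K := hu.mono hψΩ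
  have hψ1 : Continuous fun y ↦ fderiv ℝ ψ y e :=
    (hψ.continuous_fderiv (by simp)).clm_apply continuous_const
  have hψz : ∀ y ∉ K, ψ y = 0 := fun y hy ↦ image_eq_zero_of_notMem_tsupport hy
  have hψz' : ∀ y ∉ K, fderiv ℝ ψ y e = 0 := fun y hy ↦ by
    rw [fderiv_of_notMem_tsupport ℝ hy]; rfl
  have hfK : ∀ (F G : Euc n → ℝ), (∀ y ∉ K, G y = 0) →
      ∫ y, F y * G y = ∫ y in K, F y * G y := fun F G hG ↦
    (setIntegral_eq_integral_of_forall_compl_eq_zero fun y hy ↦ by simp [hG y hy]).symm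
  have hL : Tendsto (fun k ↦ ∫ y, H (f k y) * fderiv ℝ ψ y e) atTop
      (𝓝 (∫ y, H (u y) * fderiv ℝ ψ y e)) := by
    simp_rw [hfK _ _ hψz']
    exact tendsto_setIntegral_mul_of_tendstoUniformlyOn hK
      (tendstoUniformlyOn_comp_of_isCompact hK hfu huK hHc)
      (fun k ↦ (hHc.comp (hf k).continuous).continuousOn)
      (hψ1.continuousOn.integrableOn_compact hK)
  have hd : ∀ k, Continuous fun y ↦ fderiv ℝ (f k) y e := fun k ↦
    ((hf k).continuous_fderiv (by simp)).clm_apply continuous_const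
  have hR : Tendsto (fun k ↦ ∫ y, (η (f k y) * fderiv ℝ (f k) y e) * ψ y) atTop
      (𝓝 (∫ y, (η (u y) * w y) * ψ y)) := by
    simp_rw [hfK _ _ hψz]
    have := tendsto_setIntegral_mul_mul hK (tendstoUniformlyOn_comp_of_isCompact hK hfu huK hη)
      (fun k ↦ (hη.comp (hf k).continuous).continuousOn)
      (memLp_of_continuousOn_isCompact hK hψ.continuous.continuousOn) (hw K hK hψΩ)
      (fun k ↦ (hd k).continuousOn)
      (hfw () ψ (memLp_of_continuousOn_isCompact hK hψ.continuous.continuousOn))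
    simp only [comp_apply] at this
    simpa only [mul_assoc, mul_comm (ψ _)] using this
  refine tendsto_nhds_unique hL ((tendsto_congr fun k ↦ ?_).2 hR.neg)
  -- integration by parts for the smooth approximation
  have hHf : ∀ y, HasFDerivAt (fun y ↦ H (f k y)) (η (f k y) • fderiv ℝ (f k) y) y := fun y ↦
    (hH (f k y)).comp_hasFDerivAt y ((hf k).differentiable (by simp) y).hasFDerivAt
  have hc1 : Continuous fun y ↦ H (f k y) := hHc.comp (hf k).continuous
  have h1 : ∀ y, fderiv ℝ (fun y ↦ H (f k y)) y e = η (f k y) * fderiv ℝ (f k) y e := fun y ↦ by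
    rw [(hHf y).fderiv]; simp
  simp_rw [← h1]
  have hc2 : Continuous fun y ↦ fderiv ℝ (fun y ↦ H (f k y)) y e := by
    simp_rw [h1]
    exact (hη.comp (hf k).continuous).mul (hd k)
  refine integral_mul_fderiv_eq_neg_fderiv_mul_of_integrable ?_ ?_ ?_
    (fun y _ ↦ (hHf y).differentiableAt) (fun y _ ↦ hψ.differentiable (by simp) y)
  · exact (hc2.mul hψ.continuous).integrable_of_hasCompactSupport hψc.mul_left
  · refine (hc1.mul hψ1).integrable_of_hasCompactSupport (HasCompactSupport.mul_left ?_)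
    exact HasCompactSupport.intro hψc fun y hy ↦ hψz' y hy
  · exact (hc1.mul hψ.continuous).integrable_of_hasCompactSupport hψc.mul_left

/-- The local form of the fact that convex increasing functions of subsolutions are
subsolutions. Here `A` stands for the flux `√det g · g⁻¹ ∇u`, `P` for a nonnegative test function
and `B` for the pairing of `A` with the derivative of `P`, so that the hypothesis `htest` is the
weak inequality tested with the products `P * f`. Testing with `f = η ∘ u` would give the claim,
since `∇(η ∘ u)` pairs nonnegatively with the flux; `u` is approximated by smooth functions. -/
theorem setIntegral_comp_mul_nonpos {n : ℕ} {ι : Type*} [Fintype ι] {K K₁ : Set (Euc n)}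
    (hK : IsCompact K) (hK₁ : IsCompact K₁) (hKK : K ⊆ K₁) {v : Euc n} {δ : ℝ} (hδ : 0 < δ)
    (hKv : ∀ t, 0 < t → t < δ → ∀ y ∈ K, closedBall (y + t • v) (t / 2) ⊆ interior K₁)
    {u : Euc n → ℝ} (hu : ContinuousOn u K₁) {w : ι → Euc n → ℝ} {e : ι → Euc n}
    (hw : ∀ i, MemLp (w i) 2 (volume.restrict K₁))
    (hd : ∀ i, HasWeakDirDeriv (interior K₁) u (w i) (e i))
    {A : ι → Euc n → ℝ} (hA : ∀ i, MemLp (A i) 2 (volume.restrict K)) {B P : Euc n → ℝ}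
    (hB : IntegrableOn B K) (hP : ContinuousOn P K) (hP0 : ∀ y ∈ K, 0 ≤ P y)
    (hpos : ∀ y ∈ K, 0 ≤ ∑ i, A i y * w i y)
    (htest : ∀ f : Euc n → ℝ, ContDiff ℝ ∞ f → (∀ y, 0 ≤ f y) →
      ∫ y in K, (f y * B y + P y * ∑ i, A i y * fderiv ℝ f y (e i)) ≤ 0)
    {η : ℝ → ℝ} (hη : ContDiff ℝ ∞ η) (hη0 : ∀ s, 0 ≤ η s) (hηm : Monotone η) :
    ∫ y in K, η (u y) * B y ≤ 0 := by
  obtain ⟨f, hf, hfu, hfw⟩ := exists_smooth_approx hK hK₁ hKK hδ hKv hu hw hd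
  have huK : ContinuousOn u K := hu.mono hKK
  have hη1 : Continuous (deriv η) := hη.continuous_deriv (by simp)
  have hdc : ∀ k i, Continuous fun y ↦ fderiv ℝ (f k) y (e i) := fun k i ↦
    ((hf k).continuous_fderiv (by simp)).clm_apply continuous_const
  have hwK : ∀ i, MemLp (w i) 2 (volume.restrict K) := fun i ↦
    (hw i).mono_measure (Measure.restrict_mono hKK le_rfl)
  have hPA : ∀ i, MemLp (fun y ↦ P y * A i y) 2 (volume.restrict K) := fun i ↦
    memLp_continuousOn_mul hK hP (hA i)
  have hfin : IsFiniteMeasure (volume.restrict K) := ⟨by simpa using hK.measure_lt_top⟩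
  have hPAi : ∀ i, IntegrableOn (fun y ↦ P y * A i y) K := fun i ↦
    (hPA i).integrable (by norm_num)
  have hPAw : ∀ i, IntegrableOn (fun y ↦ P y * A i y * w i y) K := fun i ↦
    (hPA i).integrable_mul (hwK i)
  have h1 := tendsto_setIntegral_mul_of_tendstoUniformlyOn hK
    (tendstoUniformlyOn_comp_of_isCompact hK hfu huK hη.continuous)
    (fun k ↦ (hη.continuous.comp (hf k).continuous).continuousOn) hB
  have h2 := fun i ↦ tendsto_setIntegral_mul_mul hK
    (tendstoUniformlyOn_comp_of_isCompact hK hfu huK hη1)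
    (fun k ↦ (hη1.comp (hf k).continuous).continuousOn) (hPA i) (hwK i)
    (fun k ↦ (hdc k i).continuousOn) (hfw i _ (hPA i))
  have h3 := h1.add (tendsto_finsetSum Finset.univ fun i _ ↦ h2 i)
  have hle : (∫ y in K, (η ∘ u) y * B y)
      + ∑ i, ∫ y in K, (deriv η ∘ u) y * (P y * A i y * w i y) ≤ 0 := by
    refine le_of_tendsto h3 (.of_forall fun k ↦ ?_)
    have h4 := htest (fun y ↦ η (f k y)) (hη.comp (hf k)) (fun y ↦ hη0 _)
    have h5 : ∀ y i, fderiv ℝ (fun y ↦ η (f k y)) y (e i)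
        = deriv η (f k y) * fderiv ℝ (f k) y (e i) := fun y i ↦ by
      have := ((hη.differentiable (by simp) (f k y)).hasDerivAt.comp_hasFDerivAt y
        ((hf k).differentiable (by simp) y).hasFDerivAt).fderiv
      simp only [comp_def] at this
      rw [this]; simp
    refine le_trans (le_of_eq ?_) h4
    rw [← integral_finsetSum, ← integral_add]
    · congr 1 with y
      simp only [h5, comp_apply, Finset.mul_sum]
      congr 1
      exact Finset.sum_congr rfl fun i _ ↦ by ring
    · exact hB.continuousOn_mul (hη.continuous.comp (hf k).continuous).continuousOn hK
    · refine integrable_finsetSum _ fun i _ ↦ ?_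
      exact ((hPAi i).mul_continuousOn (hdc k i).continuousOn hK).continuousOn_mul
          (hη1.comp (hf k).continuous).continuousOn hK
    · intro i _
      exact ((hPAi i).mul_continuousOn (hdc k i).continuousOn hK).continuousOn_mul
          (hη1.comp (hf k).continuous).continuousOn hK
  have hge : 0 ≤ ∑ i, ∫ y in K, (deriv η ∘ u) y * (P y * A i y * w i y) := by
    rw [← integral_finsetSum]
    · refine setIntegral_nonneg hK.measurableSet fun y hy ↦ ?_
      have h6 : ∑ i, (deriv η ∘ u) y * (P y * A i y * w i y)
          = deriv η (u y) * P y * ∑ i, A i y * w i y := by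
        rw [Finset.mul_sum]
        exact Finset.sum_congr rfl fun i _ ↦ by simp only [comp_apply]; ring
      rw [h6]
      exact mul_nonneg (mul_nonneg hηm.deriv_nonneg (hP0 y hy)) (hpos y hy)
    · intro i _
      exact (hPAw i).continuousOn_mul
        (hη1.comp_continuousOn huK) hK
  simp only [comp_apply] at hle hge
  linarith

/-! ### The metric in a chart -/

theorem sum_smul_single {n : ℕ} (c : Euc n) :
    ∑ k, c k • EuclideanSpace.single k (1 : ℝ) = c := by
  simpa using (EuclideanSpace.basisFun (Fin n) ℝ).sum_repr c

/-- The Gram matrix of a positive definite form in a basis is invertible. -/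
theorem isUnit_det_gram_of_pos {n : ℕ} {B : Euc n →L[ℝ] Euc n →L[ℝ] ℝ}
    (hB : ∀ v, v ≠ 0 → 0 < B v v) {L : Euc n →L[ℝ] Euc n} (hL : L.IsInvertible) :
    IsUnit (Matrix.of fun i j ↦ B (L (EuclideanSpace.single i 1))
      (L (EuclideanSpace.single j 1))).det := by
  rw [isUnit_iff_ne_zero]
  intro h0
  obtain ⟨c, hc, hc0⟩ := Matrix.exists_mulVec_eq_zero_iff.2 h0
  set c' : Euc n := WithLp.toLp 2 c
  have hLc : L c' ≠ 0 := by
    obtain ⟨e, rfl⟩ := hL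
    simpa [c'] using hc
  have hexp : ∀ a, B a (L c') = ∑ j, B a (L (EuclideanSpace.single j 1)) * c j := by
    intro a
    conv_lhs => rw [← sum_smul_single c']
    simp [c', mul_comm]
  have h1 : B (L c') (L c') = 0 := by
    have h2 : ∀ i, B (L (EuclideanSpace.single i 1)) (L c') = 0 := fun i ↦ by
      rw [hexp]; exact congrFun hc0 i
    have h3 : B (L c') = ∑ i, c i • B (L (EuclideanSpace.single i 1)) := by
      conv_lhs => rw [← sum_smul_single c']
      simp [c']
    rw [h3]
    simp [h2]
  exact (hB _ hLc).ne' h1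

/-- A linear form applied to the vector `Y`, in terms of the covariant components of `Y` in a basis
and of the inverse Gram matrix. -/
theorem apply_eq_sum_inv_gram {n : ℕ} {B : Euc n →L[ℝ] Euc n →L[ℝ] ℝ}
    (hB : ∀ v, v ≠ 0 → 0 < B v v) {L : Euc n →L[ℝ] Euc n} (hL : L.IsInvertible)
    (l : Euc n →L[ℝ] ℝ) (Y : Euc n) :
    l Y = ∑ j, (∑ i, B Y (L (EuclideanSpace.single i 1)) *
      (Matrix.of fun i j ↦ B (L (EuclideanSpace.single i 1))
        (L (EuclideanSpace.single j 1)))⁻¹ i j) * l (L (EuclideanSpace.single j 1)) := by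
  have hG := isUnit_det_gram_of_pos hB hL
  set G := Matrix.of fun i j ↦ B (L (EuclideanSpace.single i 1)) (L (EuclideanSpace.single j 1))
    with hGdef
  obtain ⟨c, rfl⟩ : ∃ c, L c = Y := by
    obtain ⟨e, rfl⟩ := hL
    exact ⟨e.symm Y, by simp⟩
  have h1 : ∀ i, B (L c) (L (EuclideanSpace.single i 1)) = (Matrix.vecMul c.ofLp G) i := by
    intro i
    conv_lhs => rw [← sum_smul_single c]
    simp [Matrix.vecMul, dotProduct, hGdef]
  have h2 : ∀ j, ∑ i, B (L c) (L (EuclideanSpace.single i 1)) * G⁻¹ i j = c j := by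
    intro j
    have : Matrix.vecMul (Matrix.vecMul c.ofLp G) G⁻¹ = c.ofLp := by
      rw [Matrix.vecMul_vecMul, Matrix.mul_nonsing_inv _ hG, Matrix.vecMul_one]
    simp_rw [h1]
    exact congrFun this j
  simp_rw [h2]
  conv_lhs => rw [← sum_smul_single c]
  simp

/-- The Gram determinant is multiplied by the square of the determinant under a change of basis. -/
theorem det_gram_comp {n : ℕ} (B : Euc n →L[ℝ] Euc n →L[ℝ] ℝ) (L J : Euc n →L[ℝ] Euc n) :
    (Matrix.of fun i j ↦ B (L (J (EuclideanSpace.single i 1)))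
      (L (J (EuclideanSpace.single j 1)))).det
    = J.det ^ 2 * (Matrix.of fun i j ↦ B (L (EuclideanSpace.single i 1))
      (L (EuclideanSpace.single j 1))).det := by
  set b := (EuclideanSpace.basisFun (Fin n) ℝ).toBasis
  set A := LinearMap.toMatrix b b (J : Euc n →ₗ[ℝ] Euc n) with hA
  set G := Matrix.of fun i j ↦ B (L (EuclideanSpace.single i 1)) (L (EuclideanSpace.single j 1))
    with hG
  have hAij : ∀ i j, A i j = J (EuclideanSpace.single j 1) i := by
    intro i j
    simp [hA, b, LinearMap.toMatrix_apply]
  have h1 : (Matrix.of fun i j ↦ B (L (J (EuclideanSpace.single i 1)))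
      (L (J (EuclideanSpace.single j 1)))) = A.transpose * G * A := by
    ext i j
    rw [Matrix.of_apply, ← sum_smul_single (J (EuclideanSpace.single i 1)),
      ← sum_smul_single (J (EuclideanSpace.single j 1))]
    simp only [map_sum, map_smul, sum_apply, smul_apply,
      Matrix.mul_apply, Matrix.transpose_apply, hAij, smul_eq_mul, hG, Matrix.of_apply,
      Finset.sum_mul, Finset.mul_sum]
    refine Finset.sum_congr rfl fun k _ ↦ Finset.sum_congr rfl fun l _ ↦ by ring
  have h2 : A.det = J.det := LinearMap.det_toMatrix b _
  rw [h1, Matrix.det_mul, Matrix.det_mul, Matrix.det_transpose, h2]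
  ring

section Manifold

variable {n : ℕ} [NeZero n] {M : Type*} [TopologicalSpace M]
  [ChartedSpace (EuclideanHalfSpace n) M] [IsManifold (𝓡∂ n) ∞ M]

theorem isInvertible_mfderivWithin_symm (x : M) {y : Euc n}
    (hy : y ∈ (extChartAt (𝓡∂ n) x).target) :
    (mfderivWithin 𝓘(ℝ, Euc n) (𝓡∂ n) (extChartAt (𝓡∂ n) x).symm
      (range (𝓡∂ n)) y).IsInvertible := by
  have : IsManifold (𝓡∂ n) 1 M := IsManifold.of_le (n := ∞) (by simp)
  exact isInvertible_mfderivWithin_extChartAt_symm hy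

theorem isUnit_det_gram (g : SmoothMetric n M) (x : M) {y : Euc n}
    (hy : y ∈ (extChartAt (𝓡∂ n) x).target) : IsUnit (gram g x y).det :=
  isUnit_det_gram_of_pos (B := g.inner ((extChartAt (𝓡∂ n) x).symm y)) (g.pos _)
    (isInvertible_mfderivWithin_symm x hy)

theorem contMDiffOn_coordField (x : M) (i : Fin n) :
    ContMDiffOn 𝓘(ℝ, Euc n) (𝓡∂ n).tangent 0
      (fun y ↦ (⟨(extChartAt (𝓡∂ n) x).symm y, coordField x y i⟩ : TangentBundle (𝓡∂ n) M))
      (extChartAt (𝓡∂ n) x).target := by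
  have h1 : IsManifold (𝓡∂ n) 1 M := IsManifold.of_le (n := ∞) (by simp)
  have hud : UniqueMDiffOn 𝓘(ℝ, Euc n) (extChartAt (𝓡∂ n) x).target :=
    (uniqueDiffOn_extChartAt_target x).uniqueMDiffOn
  have h2 : ContMDiffOn 𝓘(ℝ, Euc n) (𝓡∂ n) 1 (extChartAt (𝓡∂ n) x).symm
      (extChartAt (𝓡∂ n) x).target := contMDiffOn_extChartAt_symm x
  have h3 := h2.contMDiffOn_tangentMapWithin (m := 0) (by simp) hud
  have h4 : ContMDiff 𝓘(ℝ, Euc n) 𝓘(ℝ, Euc n).tangent 0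
      (fun y : Euc n ↦ (⟨y, (EuclideanSpace.single i (1 : ℝ) : Euc n)⟩ :
        TangentBundle 𝓘(ℝ, Euc n) (Euc n))) :=
    contMDiff_vectorSpace_iff_contDiff.2 contDiff_const
  have h5 := h3.comp (s := (extChartAt (𝓡∂ n) x).target) h4.contMDiffOn (fun y hy ↦ hy)
  refine h5.congr fun y hy ↦ ?_
  simp only [comp_apply, tangentMapWithin, coordField]
  rw [(mdifferentiableWithinAt_extChartAt_symm hy).mfderivWithin_mono (hud y hy)
    (extChartAt_target_subset_range x)]

theorem continuousOn_gram (g : SmoothMetric n M) (x : M) (i j : Fin n) :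
    ContinuousOn (fun y ↦ gram g x y i j) (extChartAt (𝓡∂ n) x).target := by
  have h1 : IsManifold (𝓡∂ n) 1 M := IsManifold.of_le (n := ∞) (by simp)
  have hs : ContMDiffOn 𝓘(ℝ, Euc n) (𝓡∂ n) 0 (extChartAt (𝓡∂ n) x).symm
      (extChartAt (𝓡∂ n) x).target := (contMDiffOn_extChartAt_symm (n := 1) x).of_le (by simp)
  have hg := (g.contMDiff.of_le (m := 0) (by simp)).comp_contMDiffOn hs
  have := hg.clm_bundle_apply₂ (F₁ := Euc n) (F₂ := Euc n) (F₃ := ℝ)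
    (E₁ := fun x : M ↦ TangentSpace (𝓡∂ n) x) (E₂ := fun x : M ↦ TangentSpace (𝓡∂ n) x)
    (E₃ := Bundle.Trivial M ℝ)
    (contMDiffOn_coordField x i) (contMDiffOn_coordField x j)
  intro y hy
  have h2 := this y hy
  rw [Bundle.contMDiffWithinAt_totalSpace] at h2
  exact h2.2.continuousWithinAt

end Manifold

theorem measurableSet_extChartAt_target {n : ℕ} [NeZero n] {M : Type*} [TopologicalSpace M]
    [ChartedSpace (EuclideanHalfSpace n) M] (x : M) :
    MeasurableSet (extChartAt (𝓡∂ n) x).target := by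
  rw [extChartAt_target]
  exact (((chartAt _ x).open_target.preimage (𝓡∂ n).continuous_symm).measurableSet).inter
    (𝓡∂ n).isClosed_range.measurableSet

theorem measurableSet_target_inter_preimage_symm {n : ℕ} [NeZero n] {M : Type*}
    [TopologicalSpace M] [ChartedSpace (EuclideanHalfSpace n) M] [MeasurableSpace M] [BorelSpace M]
    (x : M) {A : Set M} (hA : MeasurableSet A) :
    MeasurableSet ((extChartAt (𝓡∂ n) x).target ∩ (extChartAt (𝓡∂ n) x).symm ⁻¹' A) := by
  have h1 := (continuousOn_iff_continuous_domRestrict.1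
    (continuousOn_extChartAt_symm (I := 𝓡∂ n) x)).measurable hA
  have h2 := (measurableSet_extChartAt_target x).subtype_image h1
  convert h2 using 1
  ext y
  constructor
  · rintro ⟨h3, h4⟩
    exact ⟨⟨y, h3⟩, h4, rfl⟩
  · rintro ⟨⟨y, h3⟩, h4, rfl⟩
    exact ⟨h3, h4⟩

/-- The `j`-th partial derivative of the coordinate expression of `φ`, taken within the half-space. -/
noncomputable def chartDeriv {n : ℕ} [NeZero n] {M : Type*} [TopologicalSpace M]
    [ChartedSpace (EuclideanHalfSpace n) M] (x : M) (φ : M → ℝ) (j : Fin n) (y : Euc n) : ℝ :=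
  fderivWithin ℝ (φ ∘ (extChartAt (𝓡∂ n) x).symm) (range (𝓡∂ n)) y
    (EuclideanSpace.single j (1 : ℝ))

section Manifold

variable {n : ℕ} [NeZero n] {M : Type*} [TopologicalSpace M]
  [ChartedSpace (EuclideanHalfSpace n) M] [IsManifold (𝓡∂ n) ∞ M]

/-- The components `√det g · ∑ᵢ Yᵢ gⁱʲ` of the vector density of a vector field `Y` in a chart. -/
noncomputable def chartFlux (g : SmoothMetric n M) (x : M) (Y : (p : M) → TangentSpace (𝓡∂ n) p) (j : Fin n)
    (y : Euc n) : ℝ :=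
  Real.sqrt (gram g x y).det * ∑ i, g.inner ((extChartAt (𝓡∂ n) x).symm y)
    (Y ((extChartAt (𝓡∂ n) x).symm y)) (coordField x y i) * (gram g x y)⁻¹ i j

theorem mfderiv_apply_coordField (x : M) {φ : M → ℝ} {y : Euc n}
    (hy : y ∈ (extChartAt (𝓡∂ n) x).target)
    (hφ : MDifferentiableAt (𝓡∂ n) 𝓘(ℝ, ℝ) φ ((extChartAt (𝓡∂ n) x).symm y)) (j : Fin n) :
    mfderiv (𝓡∂ n) 𝓘(ℝ, ℝ) φ ((extChartAt (𝓡∂ n) x).symm y) (coordField x y j)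
      = chartDeriv x φ j y := by
  have h1 : IsManifold (𝓡∂ n) 1 M := IsManifold.of_le (n := ∞) (by simp)
  have h2 := mfderiv_comp_mfderivWithin y hφ (mdifferentiableWithinAt_extChartAt_symm hy)
    ((𝓡∂ n).uniqueMDiffOn y (extChartAt_target_subset_range x hy))
  rw [mfderivWithin_eq_fderivWithin] at h2
  rw [chartDeriv, h2]
  rfl

theorem sqrt_det_mul_inner_gradient (g : SmoothMetric n M) (x : M)
    (Y : (p : M) → TangentSpace (𝓡∂ n) p) {φ : M → ℝ} {y : Euc n}
    (hy : y ∈ (extChartAt (𝓡∂ n) x).target)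
    (hφ : MDifferentiableAt (𝓡∂ n) 𝓘(ℝ, ℝ) φ ((extChartAt (𝓡∂ n) x).symm y)) :
    Real.sqrt (gram g x y).det * g.inner ((extChartAt (𝓡∂ n) x).symm y)
      (Y ((extChartAt (𝓡∂ n) x).symm y)) (gradient g φ ((extChartAt (𝓡∂ n) x).symm y))
    = ∑ j, chartFlux g x Y j y * chartDeriv x φ j y := by
  have h1 := apply_eq_sum_inv_gram (B := g.inner ((extChartAt (𝓡∂ n) x).symm y)) (g.pos _)
    (isInvertible_mfderivWithin_symm x hy)
    (mfderiv (𝓡∂ n) 𝓘(ℝ, ℝ) φ ((extChartAt (𝓡∂ n) x).symm y))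
    (Y ((extChartAt (𝓡∂ n) x).symm y))
  rw [g.symm, inner_gradient]
  refine (congrArg _ h1).trans ?_
  rw [Finset.mul_sum]
  refine Finset.sum_congr rfl fun j _ ↦ ?_
  rw [← mfderiv_apply_coordField x hy hφ, ← mul_assoc]
  rfl

theorem sum_chartFlux_mul_nonneg (g : SmoothMetric n M) (x : M)
    (Y : (p : M) → TangentSpace (𝓡∂ n) p) {y : Euc n}
    (hy : y ∈ (extChartAt (𝓡∂ n) x).target) :
    0 ≤ ∑ j, chartFlux g x Y j y * g.inner ((extChartAt (𝓡∂ n) x).symm y)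
      (Y ((extChartAt (𝓡∂ n) x).symm y)) (coordField x y j) := by
  have h1 := apply_eq_sum_inv_gram (B := g.inner ((extChartAt (𝓡∂ n) x).symm y)) (g.pos _)
    (isInvertible_mfderivWithin_symm x hy)
    (g.inner ((extChartAt (𝓡∂ n) x).symm y) (Y ((extChartAt (𝓡∂ n) x).symm y)))
    (Y ((extChartAt (𝓡∂ n) x).symm y))
  have h2 : 0 ≤ g.inner ((extChartAt (𝓡∂ n) x).symm y) (Y ((extChartAt (𝓡∂ n) x).symm y))
      (Y ((extChartAt (𝓡∂ n) x).symm y)) := by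
    by_cases h0 : Y ((extChartAt (𝓡∂ n) x).symm y) = 0
    · rw [h0, map_zero]
    · exact (g.pos _ _ h0).le
  refine (mul_nonneg (Real.sqrt_nonneg (gram g x y).det) h2).trans_eq ?_
  refine (congrArg _ h1).trans ?_
  rw [Finset.mul_sum]
  refine Finset.sum_congr rfl fun j _ ↦ ?_
  rw [← mul_assoc]
  rfl

theorem continuousOn_det_gram (g : SmoothMetric n M) (x : M) :
    ContinuousOn (fun y ↦ (gram g x y).det) (extChartAt (𝓡∂ n) x).target := by
  exact (continuous_id.matrix_det (R := ℝ)).comp_continuousOn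
    (continuousOn_pi.2 fun i ↦ continuousOn_pi.2 fun j ↦ continuousOn_gram g x i j)

theorem continuousOn_inv_gram (g : SmoothMetric n M) (x : M) (i j : Fin n) :
    ContinuousOn (fun y ↦ (gram g x y)⁻¹ i j) (extChartAt (𝓡∂ n) x).target := by
  have h1 : ContinuousOn (fun y ↦ (gram g x y).adjugate) (extChartAt (𝓡∂ n) x).target :=
    (continuous_id.matrix_adjugate (R := ℝ)).comp_continuousOn
      (continuousOn_pi.2 fun i ↦ continuousOn_pi.2 fun j ↦ continuousOn_gram g x i j)
  have h2 := (continuousOn_det_gram g x).inv₀ fun y hy ↦ (isUnit_det_gram g x hy).ne_zero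
  refine (h2.mul (continuousOn_pi.1 (continuousOn_pi.1 h1 i) j)).congr fun y hy ↦ ?_
  rw [Matrix.inv_def, Ring.inverse_eq_inv']
  rfl

theorem memLp_chartFlux (g : SmoothMetric n M) (x : M) {Y : (p : M) → TangentSpace (𝓡∂ n) p}
    {K : Set (Euc n)} (hK : IsCompact K) (hKt : K ⊆ (extChartAt (𝓡∂ n) x).target)
    (hY : ∀ i, MemLp (fun y ↦ g.inner ((extChartAt (𝓡∂ n) x).symm y)
      (Y ((extChartAt (𝓡∂ n) x).symm y)) (coordField x y i)) 2 (volume.restrict K)) (j : Fin n) :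
    MemLp (chartFlux g x Y j) 2 (volume.restrict K) := by
  refine memLp_continuousOn_mul hK ((continuousOn_det_gram g x).mono hKt).sqrt
    (memLp_finsetSum _ fun i _ ↦ ?_)
  simpa only [mul_comm] using
    memLp_continuousOn_mul hK ((continuousOn_inv_gram g x i j).mono hKt) (hY i)

/-- The transition map from the chart around `x'` to the chart around `x`, with the change of the
Gram determinant. -/
theorem det_gram_eq_of_transition (g : SmoothMetric n M) (x x' : M) {y : Euc n}
    (hy : y ∈ (extChartAt (𝓡∂ n) x').target)
    (hy' : (extChartAt (𝓡∂ n) x').symm y ∈ (extChartAt (𝓡∂ n) x).source) :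
    ∃ J : Euc n →L[ℝ] Euc n,
      HasFDerivWithinAt (extChartAt (𝓡∂ n) x ∘ (extChartAt (𝓡∂ n) x').symm) J (range (𝓡∂ n)) y ∧
      (gram g x' y).det
        = J.det ^ 2 * (gram g x ((extChartAt (𝓡∂ n) x) ((extChartAt (𝓡∂ n) x').symm y))).det := by
  have h1 : IsManifold (𝓡∂ n) 1 M := IsManifold.of_le (n := ∞) (by simp)
  set e := extChartAt (𝓡∂ n) x with he
  set e' := extChartAt (𝓡∂ n) x' with he'
  have hyr : y ∈ range (𝓡∂ n) := extChartAt_target_subset_range x' hy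
  have hud := (𝓡∂ n).uniqueMDiffOn y hyr
  have hd' : MDifferentiableWithinAt 𝓘(ℝ, Euc n) (𝓡∂ n) e'.symm (range (𝓡∂ n)) y :=
    mdifferentiableWithinAt_extChartAt_symm hy
  have hde : MDifferentiableAt (𝓡∂ n) 𝓘(ℝ, Euc n) e (e'.symm y) :=
    mdifferentiableAt_extChartAt (by rwa [he, extChartAt_source] at hy')
  have hdτ : MDifferentiableWithinAt 𝓘(ℝ, Euc n) 𝓘(ℝ, Euc n) (e ∘ e'.symm) (range (𝓡∂ n)) y :=
    hde.comp_mdifferentiableWithinAt y hd'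
  have hτt : (e ∘ e'.symm) y ∈ e.target := e.map_source hy'
  have hds : MDifferentiableWithinAt 𝓘(ℝ, Euc n) (𝓡∂ n) e.symm (range (𝓡∂ n))
      ((e ∘ e'.symm) y) := mdifferentiableWithinAt_extChartAt_symm hτt
  set J : Euc n →L[ℝ] Euc n := fderivWithin ℝ (e ∘ e'.symm) (range (𝓡∂ n)) y with hJ
  refine ⟨J, (mdifferentiableWithinAt_iff_differentiableWithinAt.1 hdτ).hasFDerivWithinAt, ?_⟩
  have hmem : (e ∘ e'.symm) ⁻¹' range (𝓡∂ n) ∈ 𝓝[range (𝓡∂ n)] y :=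
    Filter.Eventually.of_forall fun z ↦ ⟨_, rfl⟩
  have hev : e'.symm =ᶠ[𝓝[range (𝓡∂ n)] y] e.symm ∘ (e ∘ e'.symm) := by
    have h2 := hd'.continuousWithinAt.preimage_mem_nhdsWithin
      ((isOpen_extChartAt_source (I := 𝓡∂ n) x).mem_nhds hy')
    filter_upwards [h2] with z hz
    exact (e.left_inv hz).symm
  have hsy : e.symm (e (e'.symm y)) = e'.symm y := e.left_inv hy'
  have hchain : mfderivWithin 𝓘(ℝ, Euc n) (𝓡∂ n) (e.symm ∘ (e ∘ e'.symm)) (range (𝓡∂ n)) y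
      = (mfderivWithin 𝓘(ℝ, Euc n) (𝓡∂ n) e.symm (range (𝓡∂ n)) ((e ∘ e'.symm) y)).comp
        (mfderivWithin 𝓘(ℝ, Euc n) 𝓘(ℝ, Euc n) (e ∘ e'.symm) (range (𝓡∂ n)) y) :=
    mfderivWithin_comp_of_preimage_mem_nhdsWithin y hds hdτ hmem hud
  rw [mfderivWithin_eq_fderivWithin] at hchain
  have hcf : ∀ i, (coordField x' y i : Euc n)
      = (mfderivWithin 𝓘(ℝ, Euc n) (𝓡∂ n) e.symm (range (𝓡∂ n)) ((e ∘ e'.symm) y) :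
        Euc n →L[ℝ] Euc n) (J (EuclideanSpace.single i 1)) := by
    intro i
    have h3 := hev.mfderivWithin_eq (I := 𝓘(ℝ, Euc n)) (I' := 𝓡∂ n) hsy.symm
    exact (congrArg (fun L : Euc n →L[ℝ] Euc n ↦ L (EuclideanSpace.single i 1))
      (h3.trans hchain))
  have hin : ∀ (p q : M) (_ : p = q) (a b : Euc n),
      (g.inner p : Euc n →L[ℝ] Euc n →L[ℝ] ℝ) a b
        = (g.inner q : Euc n →L[ℝ] Euc n →L[ℝ] ℝ) a b := by
    rintro p q rfl a b
    rfl
  have hdet := det_gram_comp (g.inner (e.symm (e (e'.symm y))))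
    (mfderivWithin 𝓘(ℝ, Euc n) (𝓡∂ n) e.symm (range (𝓡∂ n)) ((e ∘ e'.symm) y)) J
  refine Eq.trans ?_ hdet
  congr 1
  ext i j
  exact (hin _ _ hsy.symm _ _).trans (congrArg₂ (fun a b : Euc n ↦
    (g.inner (e.symm (e (e'.symm y))) : Euc n →L[ℝ] Euc n →L[ℝ] ℝ) a b) (hcf i) (hcf j))

/-! ### The Riemannian volume in a chart -/

variable [MeasurableSpace M] [BorelSpace M]

theorem aemeasurable_extChartAt_symm (g : SmoothMetric n M) (x : M) :
    AEMeasurable (extChartAt (𝓡∂ n) x).symm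
      ((volume.restrict (extChartAt (𝓡∂ n) x).target).withDensity
        (fun y ↦ ENNReal.ofReal (Real.sqrt (gram g x y).det))) :=
  ((continuousOn_extChartAt_symm x).aemeasurable (measurableSet_extChartAt_target x)).mono_ac
    (withDensity_absolutelyContinuous _ _)

theorem chartVolume_apply (g : SmoothMetric n M) (x : M) {A : Set M} (hA : MeasurableSet A) :
    chartVolume g x A = ∫⁻ y in (extChartAt (𝓡∂ n) x).target ∩ (extChartAt (𝓡∂ n) x).symm ⁻¹' A,
      ENNReal.ofReal (Real.sqrt (gram g x y).det) := by
  rw [chartVolume, Measure.map_apply_of_aemeasurable (aemeasurable_extChartAt_symm g x) hA,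
    withDensity_apply', Measure.restrict_restrict₀', inter_comm]
  exact (measurableSet_extChartAt_target x).nullMeasurableSet

theorem chartVolume_apply_le (g : SmoothMetric n M) (x x' : M) {A : Set M} (hA : MeasurableSet A)
    (hAx : A ⊆ (extChartAt (𝓡∂ n) x).source) : chartVolume g x' A ≤ chartVolume g x A := by
  rw [chartVolume_apply g x hA, chartVolume_apply g x' hA]
  set e := extChartAt (𝓡∂ n) x
  set e' := extChartAt (𝓡∂ n) x'
  set s := e'.target ∩ e'.symm ⁻¹' A with hs
  have hJ : ∀ y, ∃ J : Euc n →L[ℝ] Euc n, y ∈ s →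
      HasFDerivWithinAt (e ∘ e'.symm) J (range (𝓡∂ n)) y ∧
      (gram g x' y).det = J.det ^ 2 * (gram g x (e (e'.symm y))).det := by
    intro y
    by_cases hy : y ∈ s
    · obtain ⟨J, h1, h2⟩ := det_gram_eq_of_transition g x x' hy.1 (hAx hy.2)
      exact ⟨J, fun _ ↦ ⟨h1, h2⟩⟩
    · exact ⟨0, fun h ↦ absurd h hy⟩
  choose J hJ using hJ
  have hsm : MeasurableSet s := measurableSet_target_inter_preimage_symm x' hA
  have hinj : InjOn (e ∘ e'.symm) s := by
    intro y hy z hz hyz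
    exact e'.symm.injOn hy.1 hz.1 (e.injOn (hAx hy.2) (hAx hz.2) hyz)
  have hcv := lintegral_image_eq_lintegral_abs_det_fderiv_mul volume hsm
    (fun y hy ↦ (hJ y hy).1.mono (inter_subset_left.trans (extChartAt_target_subset_range x')))
    hinj (fun y ↦ ENNReal.ofReal (Real.sqrt (gram g x y).det))
  calc ∫⁻ y in s, ENNReal.ofReal (Real.sqrt (gram g x' y).det)
      = ∫⁻ y in s, ENNReal.ofReal |(J y).det| *
          ENNReal.ofReal (Real.sqrt (gram g x ((e ∘ e'.symm) y)).det) := by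
        refine setLIntegral_congr_fun hsm fun y hy ↦ ?_
        simp only [comp_apply]
        rw [(hJ y hy).2, Real.sqrt_mul (sq_nonneg _), Real.sqrt_sq_eq_abs,
          ENNReal.ofReal_mul (abs_nonneg _)]
    _ = ∫⁻ y in (e ∘ e'.symm) '' s, ENNReal.ofReal (Real.sqrt (gram g x y).det) := hcv.symm
    _ ≤ _ := by
        refine lintegral_mono_set ?_
        rintro _ ⟨y, hy, rfl⟩
        refine ⟨e.map_source (hAx hy.2), ?_⟩
        simpa only [mem_preimage, comp_apply, e.left_inv (hAx hy.2)] using hy.2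

/-- The Riemannian volume is given by `√det(g_{ij}) dy` in each chart. -/
theorem riemannianVolume_restrict_source (g : SmoothMetric n M) (x : M) :
    (riemannianVolume g).restrict (extChartAt (𝓡∂ n) x).source = chartVolume g x := by
  have hsrc : MeasurableSet (extChartAt (𝓡∂ n) x).source :=
    (isOpen_extChartAt_source x).measurableSet
  refine le_antisymm ?_ ?_
  · -- a measure that dominates all chart measures and agrees with `chartVolume g x` on the source
    have hle : riemannianVolume g
        ≤ chartVolume g x + (⊤ : Measure M).restrict (extChartAt (𝓡∂ n) x).sourceᶜ := by
      refine iSup_le fun x' ↦ Measure.le_iff.2 fun A hA ↦ ?_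
      rw [← measure_inter_add_sdiff A hsrc, Measure.add_apply, Measure.restrict_apply hA]
      refine add_le_add ?_ ?_
      · exact (chartVolume_apply_le g x x' (hA.inter hsrc) inter_subset_right).trans
          (measure_mono inter_subset_left)
      · rw [sdiff_eq]
        exact Measure.le_iff'.1 le_top _
    refine Measure.le_iff.2 fun A hA ↦ ?_
    rw [Measure.restrict_apply hA]
    refine (Measure.le_iff'.1 hle _).trans ?_
    rw [Measure.add_apply, Measure.restrict_apply (hA.inter hsrc)]
    have : A ∩ (extChartAt (𝓡∂ n) x).source ∩ (extChartAt (𝓡∂ n) x).sourceᶜ = ∅ := by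
      rw [inter_assoc, inter_compl_self, inter_empty]
    rw [this, measure_empty, add_zero]
    exact measure_mono inter_subset_left
  · refine Measure.le_iff.2 fun A hA ↦ ?_
    rw [Measure.restrict_apply hA]
    have h1 : chartVolume g x A = chartVolume g x (A ∩ (extChartAt (𝓡∂ n) x).source) := by
      rw [chartVolume_apply g x hA, chartVolume_apply g x (hA.inter hsrc)]
      congr 2
      ext y
      simp only [mem_inter_iff, mem_preimage]
      exact ⟨fun h ↦ ⟨h.1, h.2, (extChartAt (𝓡∂ n) x).map_target h.1⟩, fun h ↦ ⟨h.1, h.2.1⟩⟩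
    rw [h1]
    exact Measure.le_iff'.1 (le_iSup (fun x ↦ chartVolume g x) x) _

end Manifold

theorem isCompact_extChartAt_image {n : ℕ} [NeZero n] {M : Type*} [TopologicalSpace M]
    [ChartedSpace (EuclideanHalfSpace n) M] (x : M) {K : Set M} (hK : IsCompact K)
    (hKs : K ⊆ (extChartAt (𝓡∂ n) x).source) : IsCompact (extChartAt (𝓡∂ n) x '' K) :=
  hK.image_of_continuousOn ((continuousOn_extChartAt x).mono hKs)

section Manifold

variable {n : ℕ} [NeZero n] {M : Type*} [TopologicalSpace M]
  [ChartedSpace (EuclideanHalfSpace n) M] [IsManifold (𝓡∂ n) ∞ M]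

theorem contDiffOn_comp_symm (x : M) {φ : M → ℝ} (hφ : ContMDiff (𝓡∂ n) 𝓘(ℝ, ℝ) ∞ φ) :
    ContDiffOn ℝ ∞ (φ ∘ (extChartAt (𝓡∂ n) x).symm) (extChartAt (𝓡∂ n) x).target :=
  contMDiffOn_iff_contDiffOn.1 (hφ.comp_contMDiffOn (contMDiffOn_extChartAt_symm x))

theorem differentiableWithinAt_comp_symm (x : M) {φ : M → ℝ}
    (hφ : ContMDiff (𝓡∂ n) 𝓘(ℝ, ℝ) ∞ φ) {y : Euc n} (hy : y ∈ (extChartAt (𝓡∂ n) x).target) :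
    DifferentiableWithinAt ℝ (φ ∘ (extChartAt (𝓡∂ n) x).symm) (range (𝓡∂ n)) y :=
  (((contDiffOn_comp_symm x hφ).differentiableOn (by simp)) y hy).mono_of_mem_nhdsWithin
    (extChartAt_target_mem_nhdsWithin_of_mem hy)

theorem continuousOn_chartDeriv (x : M) {φ : M → ℝ} (hφ : ContMDiff (𝓡∂ n) 𝓘(ℝ, ℝ) ∞ φ)
    (j : Fin n) : ContinuousOn (chartDeriv x φ j) (extChartAt (𝓡∂ n) x).target := by
  have h1 := contDiffOn_comp_symm x hφ
  have h2 := (h1.continuousOn_fderivWithin (uniqueDiffOn_extChartAt_target x) (by simp)).clm_apply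
    (continuousOn_const (c := (EuclideanSpace.single j (1 : ℝ) : Euc n)))
  refine h2.congr fun y hy ↦ ?_
  rw [chartDeriv, fderivWithin_of_mem_nhdsWithin (extChartAt_target_mem_nhdsWithin_of_mem hy)
    ((𝓡∂ n).uniqueDiffOn y (extChartAt_target_subset_range x hy))
    (h1.differentiableOn (by simp) y hy)]

theorem gradient_eq_zero_of_notMem_tsupport (g : SmoothMetric n M) {φ : M → ℝ} {p : M}
    (hp : p ∉ tsupport φ) : gradient g φ p = 0 := by
  have h1 : φ =ᶠ[𝓝 p] fun _ ↦ 0 := notMem_tsupport_iff_eventuallyEq.1 hp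
  rw [gradient, h1.mfderiv_eq, mfderiv_const]
  exact map_zero _

variable [MeasurableSpace M] [BorelSpace M]

/-- The Dirichlet pairing of a vector field with the gradient of a function supported in a chart
is integrable, and computed by the coordinate expression. -/
theorem integral_inner_gradient_eq (g : SmoothMetric n M) (x : M)
    {Y : (p : M) → TangentSpace (𝓡∂ n) p} {φ : M → ℝ} (hφ : ContMDiff (𝓡∂ n) 𝓘(ℝ, ℝ) ∞ φ)
    {K : Set M} (hK : IsCompact K) (hKs : K ⊆ (extChartAt (𝓡∂ n) x).source)
    (hφK : tsupport φ ⊆ K)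
    (hY : ∀ i, MemLp (fun y ↦ g.inner ((extChartAt (𝓡∂ n) x).symm y)
      (Y ((extChartAt (𝓡∂ n) x).symm y)) (coordField x y i)) 2
      (volume.restrict (extChartAt (𝓡∂ n) x '' K))) :
    IntegrableOn (fun y ↦ ∑ j, chartFlux g x Y j y * chartDeriv x φ j y)
      (extChartAt (𝓡∂ n) x '' K) ∧
    Integrable (fun p ↦ g.inner p (Y p) (gradient g φ p)) (riemannianVolume g) ∧
    ∫ p, g.inner p (Y p) (gradient g φ p) ∂(riemannianVolume g)
      = ∫ y in extChartAt (𝓡∂ n) x '' K, ∑ j, chartFlux g x Y j y * chartDeriv x φ j y := by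
  have hK' := isCompact_extChartAt_image x hK hKs
  have hvol := riemannianVolume_restrict_source g x
  have haem := aemeasurable_extChartAt_symm g x
  have htm := measurableSet_extChartAt_target (n := n) x
  have hsrc : MeasurableSet (extChartAt (𝓡∂ n) x).source :=
    (isOpen_extChartAt_source x).measurableSet
  have hρm : AEMeasurable (fun y ↦ ENNReal.ofReal (Real.sqrt (gram g x y).det))
      (volume.restrict (extChartAt (𝓡∂ n) x).target) :=
    ((continuousOn_det_gram g x).sqrt.aemeasurable htm).ennreal_ofReal
  rw [chartVolume] at hvol
  set e := extChartAt (𝓡∂ n) x with he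
  set ρ : Euc n → ℝ≥0∞ := fun y ↦ ENNReal.ofReal (Real.sqrt (gram g x y).det) with hρ
  set F : M → ℝ := fun p ↦ g.inner p (Y p) (gradient g φ p) with hF
  set R : Euc n → ℝ := fun y ↦ ∑ j, chartFlux g x Y j y * chartDeriv x φ j y with hR
  have hKt : e '' K ⊆ e.target := by
    rintro _ ⟨p, hp, rfl⟩
    exact e.map_source (hKs hp)
  have hfin : IsFiniteMeasure (volume.restrict (e '' K)) := ⟨by simpa using hK'.measure_lt_top⟩
  have hRi : IntegrableOn R (e '' K) := by
    refine integrable_finsetSum _ fun j _ ↦ ?_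
    have h1 : IntegrableOn (chartFlux g x Y j) (e '' K) :=
      (memLp_chartFlux g x hK' hKt hY j).integrable (by norm_num)
    exact h1.mul_continuousOn ((continuousOn_chartDeriv x hφ j).mono hKt) hK'
  have hF0 : ∀ p ∉ K, F p = 0 := fun p hp ↦ by
    simp only [hF]
    rw [gradient_eq_zero_of_notMem_tsupport g fun h ↦ hp (hφK h), map_zero]
  have hFR : ∀ y ∈ e.target, (ρ y).toReal • F (e.symm y) = (e '' K).indicator R y := by
    intro y hy
    by_cases hyK : y ∈ e '' K
    · rw [indicator_of_mem hyK, hR, ENNReal.toReal_ofReal (Real.sqrt_nonneg _), smul_eq_mul]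
      exact sqrt_det_mul_inner_gradient g x Y hy (hφ.mdifferentiableAt (by simp))
    · rw [indicator_of_notMem hyK, hF0, smul_zero]
      exact fun h ↦ hyK ⟨_, h, e.right_inv hy⟩
  have hFR' : (fun y ↦ (ρ y).toReal • F (e.symm y)) =ᵐ[volume.restrict e.target]
      (e '' K).indicator R := (ae_restrict_mem htm).mono hFR
  have hind : Integrable ((e '' K).indicator R) (volume.restrict e.target) :=
    ((integrable_indicator_iff hK'.measurableSet).2 hRi).integrableOn
  have hν : Integrable (F ∘ e.symm) ((volume.restrict e.target).withDensity ρ) :=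
    (integrable_withDensity_iff_integrable_smul₀' hρm
      (.of_forall fun _ ↦ ENNReal.ofReal_lt_top)).2 (hind.congr hFR'.symm)
  -- measurability is transported from the chart to the manifold
  have hFm : AEStronglyMeasurable F (((volume.restrict e.target).withDensity ρ).map e.symm) := by
    have h1 : AEMeasurable e (((volume.restrict e.target).withDensity ρ).map e.symm) := by
      rw [← hvol]
      exact (continuousOn_extChartAt x).aemeasurable hsrc
    have h2 : (((volume.restrict e.target).withDensity ρ).map e.symm).map e
        = (volume.restrict e.target).withDensity ρ := by
      rw [AEMeasurable.map_map_of_aemeasurable h1 haem]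
      refine (Measure.map_congr ?_).trans Measure.map_id
      refine (withDensity_absolutelyContinuous _ _).ae_le ?_
      exact (ae_restrict_mem htm).mono fun y hy ↦ e.right_inv hy
    have h3 := hν.1
    rw [← h2] at h3
    refine (h3.comp_aemeasurable h1).congr ?_
    rw [← hvol]
    refine (ae_restrict_mem hsrc).mono fun p hp ↦ ?_
    simp only [comp_apply]
    rw [e.left_inv hp]
  have hsupp : support F ⊆ e.source := fun p hp ↦ hKs (not_imp_comm.1 (hF0 p) hp)
  refine ⟨hRi, ?_, ?_⟩
  · rw [← integrableOn_iff_integrable_of_support_subset hsupp, IntegrableOn, hvol]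
    exact (integrable_map_measure hFm haem).2 hν
  · rw [← setIntegral_eq_integral_of_forall_compl_eq_zero (s := e.source)
      fun p hp ↦ notMem_support.1 fun h ↦ hp (hsupp h), hvol, integral_map haem hFm,
      integral_withDensity_eq_integral_toReal_smul₀ hρm
        (.of_forall fun _ ↦ ENNReal.ofReal_lt_top), integral_congr_ae hFR',
      setIntegral_indicator hK'.measurableSet, inter_eq_self_of_subset_right hKt]

end Manifold

/-! ### Increasing convex functions of weak subsolutions -/

/-- In the half-space, the points of a compact subset of a relatively open set can be moved
inwards within a compact subset of that set. -/
theorem exists_isCompact_inward {n : ℕ} [NeZero n] {O K : Set (Euc n)} (hO : IsOpen O)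
    (hK : IsCompact K) (hKO : K ⊆ O ∩ range (𝓡∂ n)) :
    ∃ K₁ : Set (Euc n), IsCompact K₁ ∧ K ⊆ K₁ ∧ K₁ ⊆ O ∩ range (𝓡∂ n) ∧ ∃ δ > 0,
      ∀ t, 0 < t → t < δ → ∀ y ∈ K,
        closedBall (y + t • EuclideanSpace.single (0 : Fin n) (1 : ℝ)) (t / 2) ⊆ interior K₁ := by
  obtain ⟨r, hr, hrO⟩ := hK.exists_cthickening_subset_open hO (hKO.trans inter_subset_left)
  refine ⟨cthickening r K ∩ range (𝓡∂ n), hK.cthickening.inter_right (𝓡∂ n).isClosed_range,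
    subset_inter (self_subset_cthickening K) (hKO.trans inter_subset_right),
    inter_subset_inter_left _ hrO, r / 2, half_pos hr, fun t ht htr y hy z hz ↦ ?_⟩
  rw [interior_inter]
  rw [mem_closedBall, dist_eq_norm] at hz
  constructor
  · refine interior_maximal (thickening_subset_cthickening r K) isOpen_thickening ?_
    refine mem_thickening_iff.2 ⟨y, hy, ?_⟩
    rw [dist_eq_norm]
    have h1 : z - y = (z - (y + t • EuclideanSpace.single (0 : Fin n) (1 : ℝ)))
        + t • EuclideanSpace.single (0 : Fin n) (1 : ℝ) := by abel
    have h2 : ‖t • (EuclideanSpace.single (0 : Fin n) (1 : ℝ) : Euc n)‖ = t := by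
      simp [norm_smul, abs_of_pos ht]
    have h3 := norm_add_le (z - (y + t • EuclideanSpace.single (0 : Fin n) (1 : ℝ)))
      (t • (EuclideanSpace.single (0 : Fin n) (1 : ℝ) : Euc n))
    rw [← h1, h2] at h3
    linarith
  · rw [interior_range_modelWithCornersEuclideanHalfSpace]
    have h1 := hKO hy |>.2
    rw [range_modelWithCornersEuclideanHalfSpace] at h1
    have h2 := (PiLp.norm_apply_le (z - (y + t • EuclideanSpace.single (0 : Fin n) (1 : ℝ)))
      0).trans hz
    simp only [PiLp.sub_apply, PiLp.add_apply, PiLp.smul_apply, PiLp.single_apply,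
      if_true, smul_eq_mul, mul_one, Real.norm_eq_abs] at h2
    simp only [mem_ofPred_eq] at h1 ⊢
    linarith [(abs_le.1 h2).1]

/-- The coordinate image of an open set is relatively open in the half-space. -/
theorem exists_isOpen_target_inter_preimage {n : ℕ} [NeZero n] {M : Type*} [TopologicalSpace M]
    [ChartedSpace (EuclideanHalfSpace n) M] (x : M) {D : Set M} (hD : IsOpen D) :
    ∃ O : Set (Euc n), IsOpen O ∧
      (extChartAt (𝓡∂ n) x).target ∩ (extChartAt (𝓡∂ n) x).symm ⁻¹' D = O ∩ range (𝓡∂ n) := by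
  refine ⟨(𝓡∂ n).symm ⁻¹' ((chartAt _ x).target ∩ (chartAt _ x).symm ⁻¹' D),
    ((chartAt _ x).isOpen_inter_preimage_symm hD).preimage (𝓡∂ n).continuous_symm, ?_⟩
  rw [extChartAt_target]
  ext y
  simp only [mem_inter_iff, mem_preimage, extChartAt_coe_symm, comp_apply]
  tauto

theorem mfderiv_finsetSum_apply {n : ℕ} [NeZero n] {M : Type*} [TopologicalSpace M]
    [ChartedSpace (EuclideanHalfSpace n) M] {ι : Type*} (s : Finset ι) {f : ι → M → ℝ} {p : M}
    (hf : ∀ i, MDifferentiableAt (𝓡∂ n) 𝓘(ℝ, ℝ) (f i) p) (v : TangentSpace (𝓡∂ n) p) :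
    mfderiv (𝓡∂ n) 𝓘(ℝ, ℝ) (fun q ↦ ∑ i ∈ s, f i q) p v
      = ∑ i ∈ s, mfderiv (𝓡∂ n) 𝓘(ℝ, ℝ) (f i) p v := by
  classical
  let f' : ι → TangentSpace (𝓡∂ n) p →L[ℝ] ℝ := fun i ↦ mfderiv (𝓡∂ n) 𝓘(ℝ, ℝ) (f i) p
  have h : ∃ L : TangentSpace (𝓡∂ n) p →L[ℝ] ℝ,
      HasMFDerivAt (𝓡∂ n) 𝓘(ℝ, ℝ) (fun q ↦ ∑ i ∈ s, f i q) p L ∧ L v = ∑ i ∈ s, f' i v := by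
    induction s using Finset.induction_on with
    | empty => exact ⟨0, hasMFDerivAt_const (I := 𝓡∂ n) (I' := 𝓘(ℝ, ℝ)) (0 : ℝ) p, rfl⟩
    | insert i s hi IH =>
      obtain ⟨L, hL, hLv⟩ := IH
      refine ⟨f' i + L, ((hf i).hasMFDerivAt.add hL).congr_of_eventuallyEq
        (.of_forall fun q ↦ Finset.sum_insert hi), ?_⟩
      rw [Finset.sum_insert hi, ← hLv]
      rfl
  obtain ⟨L, hL, hLv⟩ := h
  rw [hL.mfderiv]
  exact hLv

section Manifold

variable {n : ℕ} [NeZero n] {M : Type*} [TopologicalSpace M]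
  [ChartedSpace (EuclideanHalfSpace n) M] [IsManifold (𝓡∂ n) ∞ M]

/-- The product of a test function supported in a chart with a smooth function of the
coordinates. -/
theorem contMDiff_mul_comp_extChartAt (x : M) {φ : M → ℝ} (hφ : ContMDiff (𝓡∂ n) 𝓘(ℝ, ℝ) ∞ φ)
    (hφs : tsupport φ ⊆ (extChartAt (𝓡∂ n) x).source) {f : Euc n → ℝ} (hf : ContDiff ℝ ∞ f) :
    ContMDiff (𝓡∂ n) 𝓘(ℝ, ℝ) ∞ (fun p ↦ φ p * f (extChartAt (𝓡∂ n) x p)) := by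
  refine contMDiff_of_tsupport fun p hp ↦ ?_
  have hps : p ∈ (chartAt (EuclideanHalfSpace n) x).source := by
    rw [← extChartAt_source (𝓡∂ n)]
    exact hφs (tsupport_mul_subset_left hp)
  exact (hφ.contMDiffAt).mul (hf.contMDiff.contMDiffAt.comp p (contMDiffAt_extChartAt' hps))

theorem chartDeriv_mul_comp_extChartAt (x : M) {φ : M → ℝ}
    (hφ : ContMDiff (𝓡∂ n) 𝓘(ℝ, ℝ) ∞ φ) {f : Euc n → ℝ} (hf : ContDiff ℝ ∞ f) {y : Euc n}
    (hy : y ∈ (extChartAt (𝓡∂ n) x).target) (j : Fin n) :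
    chartDeriv x (fun p ↦ φ p * f (extChartAt (𝓡∂ n) x p)) j y
      = f y * chartDeriv x φ j y + φ ((extChartAt (𝓡∂ n) x).symm y)
        * fderiv ℝ f y (EuclideanSpace.single j (1 : ℝ)) := by
  have hu := (𝓡∂ n).uniqueDiffOn y (extChartAt_target_subset_range x hy)
  have h1 : (fun p ↦ φ p * f (extChartAt (𝓡∂ n) x p)) ∘ (extChartAt (𝓡∂ n) x).symm
      =ᶠ[𝓝[range (𝓡∂ n)] y] fun z ↦ (φ ∘ (extChartAt (𝓡∂ n) x).symm) z * f z := by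
    filter_upwards [extChartAt_target_mem_nhdsWithin_of_mem hy] with z hz
    simp only [comp_apply, (extChartAt (𝓡∂ n) x).right_inv hz]
  have h2 := fderivWithin_mul hu (differentiableWithinAt_comp_symm x hφ hy)
    (hf.differentiable (by simp) y).differentiableWithinAt
  rw [chartDeriv, h1.fderivWithin_eq_of_mem (extChartAt_target_subset_range x hy)]
  refine (congrArg (fun L : Euc n →L[ℝ] ℝ ↦ L (EuclideanSpace.single j 1)) h2).trans ?_
  rw [fderivWithin_eq_fderiv hu (hf.differentiable (by simp) y)]
  simp only [add_apply, smul_apply, smul_eq_mul, comp_apply, chartDeriv]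
  ring

variable [MeasurableSpace M]

/-- The inequality `∫ ⟨η(u) ∇u, ∇φ⟩ ≤ 0` for a nonnegative increasing function `η` of a weak
Neumann subsolution `u`, tested with functions `φ` supported in a chart. -/
theorem integral_inner_gradient_nonpos_of_tsupport_subset_source [BorelSpace M] (g : SmoothMetric n M)
    {D : Set M} (hD : IsOpen D) {u : M → ℝ} (hu : ContinuousOn u D)
    {X Y : (p : M) → TangentSpace (𝓡∂ n) p} (hX : HasWeakGradient g D u X)
    (hsub : ∀ φ : M → ℝ, ContMDiff (𝓡∂ n) 𝓘(ℝ, ℝ) ∞ φ → HasCompactSupport φ → tsupport φ ⊆ D →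
      (∀ p, 0 ≤ φ p) →
      0 ≤ -∫ p in D, g.inner p (X p) (gradient g φ p) ∂(riemannianVolume g))
    {η : ℝ → ℝ} (hη : ContDiff ℝ ∞ η) (hη0 : ∀ s, 0 ≤ η s) (hηm : Monotone η)
    (hY : ∀ p ∈ D, Y p = η (u p) • X p) (x : M)
    {φ : M → ℝ} (hφ : ContMDiff (𝓡∂ n) 𝓘(ℝ, ℝ) ∞ φ) (hφc : HasCompactSupport φ)
    (hφD : tsupport φ ⊆ D) (hφs : tsupport φ ⊆ (extChartAt (𝓡∂ n) x).source)
    (hφ0 : ∀ p, 0 ≤ φ p) :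
    Integrable (fun p ↦ g.inner p (Y p) (gradient g φ p)) (riemannianVolume g) ∧
    ∫ p, g.inner p (Y p) (gradient g φ p) ∂(riemannianVolume g) ≤ 0 := by
  have hK := isCompact_extChartAt_image (n := n) x hφc hφs
  set e := extChartAt (𝓡∂ n) x with he
  set K := e '' tsupport φ with hKdef
  have hKS : K ⊆ e.target ∩ e.symm ⁻¹' D := by
    rintro _ ⟨p, hp, rfl⟩
    refine ⟨e.map_source (hφs hp), ?_⟩
    rw [mem_preimage, e.left_inv (hφs hp)]
    exact hφD hp
  have hKt : K ⊆ e.target := hKS.trans inter_subset_left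
  have huS : ContinuousOn (fun y ↦ u (e.symm y)) (e.target ∩ e.symm ⁻¹' D) :=
    hu.comp ((continuousOn_extChartAt_symm x).mono inter_subset_left) fun y hy ↦ hy.2
  have hXK : ∀ i, MemLp (fun y ↦ g.inner (e.symm y) (X (e.symm y)) (coordField x y i)) 2
      (volume.restrict K) := fun i ↦ hX.memL2Loc_gradient x i K hK hKS
  have hYX : ∀ y ∈ K, ∀ i, g.inner (e.symm y) (Y (e.symm y)) (coordField x y i)
      = η (u (e.symm y)) * g.inner (e.symm y) (X (e.symm y)) (coordField x y i) := by
    intro y hy i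
    rw [hY _ (hKS hy).2, map_smul, smul_apply, smul_eq_mul]
  have hYK : ∀ i, MemLp (fun y ↦ g.inner (e.symm y) (Y (e.symm y)) (coordField x y i)) 2
      (volume.restrict K) := fun i ↦
    (memLp_congr_ae ((ae_restrict_mem hK.measurableSet).mono fun y hy ↦ hYX y hy i)).2
      (memLp_continuousOn_mul hK (hη.continuous.comp_continuousOn (huS.mono hKS)) (hXK i))
  obtain ⟨-, hint, heq⟩ := integral_inner_gradient_eq g x hφ hφc hφs Subset.rfl hYK
  obtain ⟨hB, -, -⟩ := integral_inner_gradient_eq g x hφ hφc hφs Subset.rfl hXK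
  refine ⟨hint, ?_⟩
  rw [heq]
  have hflux : ∀ y ∈ K, ∑ j, chartFlux g x Y j y * chartDeriv x φ j y
      = η (u (e.symm y)) * ∑ j, chartFlux g x X j y * chartDeriv x φ j y := by
    intro y hy
    rw [Finset.mul_sum]
    refine Finset.sum_congr rfl fun j _ ↦ ?_
    have h1 : chartFlux g x Y j y = η (u (e.symm y)) * chartFlux g x X j y := by
      rw [chartFlux, chartFlux, mul_left_comm, Finset.mul_sum (a := η (u (e.symm y)))]
      refine congrArg _ (Finset.sum_congr rfl fun i _ ↦ ?_)
      rw [← mul_assoc]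
      exact congrArg (· * _) (hYX y hy i)
    rw [h1, mul_assoc]
  rw [setIntegral_congr_fun hK.measurableSet hflux]
  obtain ⟨O, hO, hSO⟩ := exists_isOpen_target_inter_preimage (n := n) x hD
  obtain ⟨K₁, hK₁, hKK₁, hK₁O, δ, hδ, hball⟩ := exists_isCompact_inward hO hK (hSO ▸ hKS)
  have hK₁S : K₁ ⊆ e.target ∩ e.symm ⁻¹' D := hSO ▸ hK₁O
  refine setIntegral_comp_mul_nonpos (P := fun y ↦ φ (e.symm y)) hK hK₁ hKK₁ hδ hball
    (huS.mono hK₁S) (fun i ↦ hX.memL2Loc_gradient x i K₁ hK₁ hK₁S)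
    (fun i ↦ (hX.weakDeriv x i).mono (interior_mono hK₁S))
    (fun j ↦ memLp_chartFlux g x hK hKt hXK j) hB
    (hφ.continuous.comp_continuousOn ((continuousOn_extChartAt_symm x).mono hKt))
    (fun y _ ↦ hφ0 _) (fun y hy ↦ sum_chartFlux_mul_nonneg g x X (hKt hy)) ?_ hη hη0 hηm
  intro f hf hf0
  have hΦ := contMDiff_mul_comp_extChartAt x hφ hφs hf
  have hΦt : tsupport (fun p ↦ φ p * f (e p)) ⊆ tsupport φ := tsupport_mul_subset_left
  have h1 := hsub _ hΦ hφc.mul_right (hΦt.trans hφD) fun p ↦ mul_nonneg (hφ0 p) (hf0 _)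
  obtain ⟨-, -, h2⟩ := integral_inner_gradient_eq g x hΦ hφc hφs hΦt hXK
  rw [setIntegral_eq_integral_of_forall_compl_eq_zero, h2, neg_nonneg] at h1
  · refine le_of_eq_of_le (setIntegral_congr_fun hK.measurableSet fun y hy ↦ ?_) h1
    simp only [Finset.mul_sum, ← Finset.sum_add_distrib]
    refine Finset.sum_congr rfl fun j _ ↦ ?_
    rw [chartDeriv_mul_comp_extChartAt x hφ hf (hKt hy)]
    ring
  · intro p hp
    rw [gradient_eq_zero_of_notMem_tsupport g fun h ↦ hp (hφD (hΦt h)), map_zero]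

variable [T2Space M] [SecondCountableTopology M]

/-- The inequality `∫ ⟨Y, ∇φ⟩ ≤ 0` is local: it follows from its validity for test functions
supported in charts. The vector field `Y` vanishes outside a closed subset of `D`, so that the
test functions need not be supported in `D`. -/
theorem integral_inner_gradient_nonpos_of_local (g : SmoothMetric n M) {D C U : Set M}
    (hD : IsOpen D) (hC : IsClosed C) (hCD : C ⊆ D) (hU : IsOpen U) (hUC : U ⊆ C)
    {Y : (p : M) → TangentSpace (𝓡∂ n) p} (hY : ∀ p ∉ U, Y p = 0)
    (hloc : ∀ (x : M) (φ : M → ℝ), ContMDiff (𝓡∂ n) 𝓘(ℝ, ℝ) ∞ φ → HasCompactSupport φ →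
      tsupport φ ⊆ D → tsupport φ ⊆ (extChartAt (𝓡∂ n) x).source → (∀ p, 0 ≤ φ p) →
      Integrable (fun p ↦ g.inner p (Y p) (gradient g φ p)) (riemannianVolume g) ∧
      ∫ p, g.inner p (Y p) (gradient g φ p) ∂(riemannianVolume g) ≤ 0)
    {φ : M → ℝ} (hφ : ContMDiff (𝓡∂ n) 𝓘(ℝ, ℝ) ∞ φ) (hφc : HasCompactSupport φ)
    (hφ0 : ∀ p, 0 ≤ φ p) :
    ∫ p, g.inner p (Y p) (gradient g φ p) ∂(riemannianVolume g) ≤ 0 := by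
  have hlc : LocallyCompactSpace M := Manifold.locallyCompact_of_finiteDimensional (𝓡∂ n)
  obtain ⟨ρ, hρ⟩ := SmoothPartitionOfUnity.exists_isSubordinate (𝓡∂ n) hC
    (fun x : M ↦ (extChartAt (𝓡∂ n) x).source ∩ D)
    (fun x ↦ (isOpen_extChartAt_source x).inter hD)
    (fun p hp ↦ mem_iUnion.2 ⟨p, mem_extChartAt_source p, hCD hp⟩)
  have hfin := ρ.locallyFinite.finite_nonempty_inter_compact hφc
  set s := hfin.toFinset with hs
  have hρφ : ∀ i, ContMDiff (𝓡∂ n) 𝓘(ℝ, ℝ) ∞ (fun p ↦ ρ i p * φ p) := fun i ↦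
    (ρ i).contMDiff.mul hφ
  have hi := fun i ↦ hloc i (fun p ↦ ρ i p * φ p) (hρφ i) hφc.mul_left
    ((tsupport_mul_subset_left.trans (hρ i)).trans inter_subset_right)
    ((tsupport_mul_subset_left.trans (hρ i)).trans inter_subset_left)
    (fun p ↦ mul_nonneg (ρ.nonneg i p) (hφ0 p))
  have hsum : ∀ q ∈ U, φ q = ∑ i ∈ s, ρ i q * φ q := by
    intro q hq
    by_cases hq0 : q ∈ tsupport φ
    · rw [← Finset.sum_mul, ρ.sum_finsupport' q (hUC hq), one_mul]
      intro i hi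
      exact hfin.mem_toFinset.2 ⟨q, (ρ.mem_finsupport q).1 hi, hq0⟩
    · simp [image_eq_zero_of_notMem_tsupport hq0]
  have key : ∀ p, g.inner p (Y p) (gradient g φ p)
      = ∑ i ∈ s, g.inner p (Y p) (gradient g (fun p ↦ ρ i p * φ p) p) := by
    intro p
    by_cases hp : p ∈ U
    · simp only [g.symm p (Y p), inner_gradient]
      have h1 : φ =ᶠ[𝓝 p] fun q ↦ ∑ i ∈ s, ρ i q * φ q :=
        (hU.mem_nhds hp |> Filter.mem_of_superset <| hsum)
      rw [h1.mfderiv_eq]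
      exact mfderiv_finsetSum_apply s (fun i ↦ (hρφ i).mdifferentiableAt (by simp)) (Y p)
    · simp [hY p hp]
  simp_rw [key]
  rw [integral_finsetSum _ fun i _ ↦ (hi i).1]
  exact Finset.sum_nonpos fun i _ ↦ (hi i).2

end Manifold

/-- A weak derivative on `Ω'` of a function that vanishes off a relatively closed subset of `Ω'`
is, after extension by zero, a weak derivative on the larger open set `Ω`. -/
theorem HasWeakDirDeriv.extend {n : ℕ} {Ω Ω' : Set (Euc n)} {e : Euc n}
    {f w F W : Euc n → ℝ} (h : HasWeakDirDeriv Ω' f w e) (hΩ' : IsOpen Ω') {C : Set (Euc n)}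
    (hC : ∀ K ⊆ Ω, IsCompact K → IsCompact (K ∩ C)) (hCΩ : Ω ∩ C ⊆ Ω')
    (hF : ∀ y ∈ Ω', F y = f y) (hW : ∀ y ∈ Ω', W y = w y)
    (hF0 : ∀ y ∉ C, F y = 0) (hW0 : ∀ y ∉ C, W y = 0) : HasWeakDirDeriv Ω F W e := by
  intro ψ hψ hψc hψΩ
  have hK : IsCompact (tsupport ψ ∩ C) := hC _ hψΩ hψc
  have hKΩ : tsupport ψ ∩ C ⊆ Ω' := (inter_subset_inter_left _ hψΩ).trans hCΩ
  obtain ⟨T, hT, hKT, hTΩ⟩ := exists_compact_between hK hΩ' hKΩ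
  obtain ⟨χ, hχ1, hχ0, -⟩ := exists_contMDiffMap_one_nhds_of_subset_interior 𝓘(ℝ, Euc n)
    (n := (⊤ : ℕ∞)) hK.isClosed hKT
  have hχ : ContDiff ℝ ∞ χ := χ.contMDiff.contDiff
  have hχt : tsupport χ ⊆ T :=
    closure_minimal (fun y hy ↦ not_imp_comm.1 (hχ0 y) hy) hT.isClosed
  have hχK : ∀ y ∈ tsupport ψ ∩ C, (χ : Euc n → ℝ) =ᶠ[𝓝 y] 1 := fun y hy ↦
    (eventually_nhdsSet_iff_forall.1 hχ1 y hy)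
  have h1 := h (fun y ↦ χ y * ψ y) (hχ.mul hψ) hψc.mul_left
    ((tsupport_mul_subset_left.trans hχt).trans hTΩ)
  have hχψt : tsupport (fun y ↦ χ y * ψ y) ⊆ Ω' ∩ tsupport ψ :=
    subset_inter ((tsupport_mul_subset_left.trans hχt).trans hTΩ) tsupport_mul_subset_right
  have hL : ∀ y, F y * fderiv ℝ ψ y e = f y * fderiv ℝ (fun y ↦ χ y * ψ y) y e := by
    intro y
    by_cases hy : y ∈ tsupport ψ ∩ C
    · have h2 : (fun y ↦ χ y * ψ y) =ᶠ[𝓝 y] ψ := by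
        filter_upwards [hχK y hy] with z hz
        simp [hz]
      rw [h2.fderiv_eq, hF y (hKΩ hy)]
    · by_cases hyt : y ∈ tsupport (fun y ↦ χ y * ψ y)
      · have h3 := hχψt hyt
        rw [← hF y h3.1, hF0 y fun hyC ↦ hy ⟨h3.2, hyC⟩, zero_mul, zero_mul]
      · rw [fderiv_of_notMem_tsupport ℝ hyt]
        by_cases hyψ : y ∈ tsupport ψ
        · simp [hF0 y fun hyC ↦ hy ⟨hyψ, hyC⟩]
        · simp [fderiv_of_notMem_tsupport ℝ hyψ]
  have hR : ∀ y, W y * ψ y = w y * (χ y * ψ y) := by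
    intro y
    by_cases hy : y ∈ tsupport ψ ∩ C
    · rw [hW y (hKΩ hy), (hχK y hy).self_of_nhds]
      simp
    · by_cases hyψ : y ∈ tsupport ψ
      · have hyC : y ∉ C := fun hyC ↦ hy ⟨hyψ, hyC⟩
        rw [hW0 y hyC, zero_mul]
        by_cases hyt : y ∈ tsupport (fun y ↦ χ y * ψ y)
        · rw [← hW y (hχψt hyt).1, hW0 y hyC, zero_mul]
        · rw [show χ y * ψ y = 0 from image_eq_zero_of_notMem_tsupport (f := fun y ↦ χ y * ψ y) hyt,
            mul_zero]
      · simp [image_eq_zero_of_notMem_tsupport hyψ]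
  simp_rw [hL, hR]
  exact h1

section Manifold

variable {n : ℕ} [NeZero n] {M : Type*} [TopologicalSpace M]
  [ChartedSpace (EuclideanHalfSpace n) M] [IsManifold (𝓡∂ n) ∞ M]

theorem HasWeakGradient.mono {g : SmoothMetric n M} {D D' : Set M} {u : M → ℝ}
    {X : (p : M) → TangentSpace (𝓡∂ n) p} (h : HasWeakGradient g D u X) (hD : D' ⊆ D) :
    HasWeakGradient g D' u X where
  memL2Loc x := (h.memL2Loc x).mono (inter_subset_inter_right _ (preimage_mono hD))
  memL2Loc_gradient x i :=
    (h.memL2Loc_gradient x i).mono (inter_subset_inter_right _ (preimage_mono hD))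
  weakDeriv x i :=
    (h.weakDeriv x i).mono (interior_mono (inter_subset_inter_right _ (preimage_mono hD)))

/-- The chain rule in `W^{1,2}_loc`, for a composition `H ∘ u` that vanishes outside a closed subset
of the domain `D` of `u` and is extended by zero to the manifold. -/
theorem HasWeakGradient.comp_extend {g : SmoothMetric n M} {D C : Set M} (hD : IsOpen D)
    (hC : IsClosed C) (hCD : C ⊆ D) {u v : M → ℝ} (hu : ContinuousOn u D) (hv : Continuous v)
    {X Y : (p : M) → TangentSpace (𝓡∂ n) p} (h : HasWeakGradient g D u X)
    {H η : ℝ → ℝ} (hH : ∀ s, HasDerivAt H (η s) s) (hη : Continuous η)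
    (hvH : ∀ p ∈ D, v p = H (u p)) (hYX : ∀ p ∈ D, Y p = η (u p) • X p)
    (hv0 : ∀ p ∉ C, v p = 0) (hY0 : ∀ p ∉ C, Y p = 0) : HasWeakGradient g univ v Y := by
  have hcc : ∀ (x : M) (K : Set (Euc n)), K ⊆ (extChartAt (𝓡∂ n) x).target → IsCompact K →
      IsCompact (K ∩ (extChartAt (𝓡∂ n) x).symm ⁻¹' C) := fun x K hKt hK ↦
    hK.of_isClosed_subset (((continuousOn_extChartAt_symm x).mono
      hKt).preimage_isClosed_of_isClosed hK.isClosed hC) inter_subset_left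
  have huc : ∀ x : M, ContinuousOn (fun y ↦ u ((extChartAt (𝓡∂ n) x).symm y))
      ((extChartAt (𝓡∂ n) x).target ∩ (extChartAt (𝓡∂ n) x).symm ⁻¹' D) := fun x ↦
    hu.comp ((continuousOn_extChartAt_symm x).mono inter_subset_left) fun y hy ↦ hy.2
  have hin : ∀ p ∈ D, ∀ a : TangentSpace (𝓡∂ n) p,
      g.inner p (Y p) a = η (u p) * g.inner p (X p) a := by
    intro p hp a
    rw [hYX p hp, map_smul, smul_apply, smul_eq_mul]
  refine ⟨fun x K hK hKS ↦ ?_, fun x i K hK hKS ↦ ?_, fun x i ↦ ?_⟩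
  · exact memLp_of_continuousOn_isCompact hK (hv.comp_continuousOn
      ((continuousOn_extChartAt_symm x).mono (hKS.trans inter_subset_left)))
  · set e := extChartAt (𝓡∂ n) x with he
    have hKt : K ⊆ e.target := hKS.trans inter_subset_left
    have hK' := hcc x K hKt hK
    set K' := K ∩ e.symm ⁻¹' C with hK'def
    have hK'S : K' ⊆ e.target ∩ e.symm ⁻¹' D := fun y hy ↦ ⟨hKt hy.1, hCD hy.2⟩
    have h1 := (memLp_indicator_iff_restrict hK'.measurableSet).2
      (memLp_continuousOn_mul hK' (hη.comp_continuousOn ((huc x).mono hK'S))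
        (h.memL2Loc_gradient x i K' hK' hK'S))
    refine (memLp_congr_ae ((ae_restrict_mem hK.measurableSet).mono fun y hy ↦ ?_)).2
      (h1.restrict K)
    by_cases hyC : e.symm y ∈ C
    · rw [indicator_of_mem (show y ∈ K' from ⟨hy, hyC⟩), hin _ (hCD hyC)]
      rfl
    · rw [indicator_of_notMem fun h ↦ hyC h.2, hY0 _ hyC, map_zero]
      rfl
  · set e := extChartAt (𝓡∂ n) x with he
    have hsub : interior (e.target ∩ e.symm ⁻¹' D) ⊆ e.target ∩ e.symm ⁻¹' D := interior_subset
    have h1 := (h.weakDeriv x i).comp isOpen_interior ((huc x).mono hsub)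
      ((h.memL2Loc_gradient x i).mono hsub) hH hη
    refine h1.extend isOpen_interior (C := e.symm ⁻¹' C) (fun K hK hKc ↦ ?_) ?_
      (fun y hy ↦ hvH _ (hsub hy).2) (fun y hy ↦ hin _ (hsub hy).2 _) (fun y hy ↦ hv0 _ hy)
      (fun y hy ↦ ?_)
    · exact hcc x K (hK.trans (interior_subset.trans inter_subset_left)) hKc
    · rintro y ⟨hy, hyC⟩
      rw [preimage_univ, inter_univ] at hy
      have hyt : e.target ∈ 𝓝 y := mem_interior_iff_mem_nhds.1 hy
      have hcy : ContinuousAt e.symm y :=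
        (continuousOn_extChartAt_symm x).continuousAt hyt
      exact mem_interior_iff_mem_nhds.2
        (Filter.inter_mem hyt (hcy (hD.mem_nhds (hCD hyC))))
    · rw [hY0 _ hy, map_zero]
      rfl

variable [MeasurableSpace M]

theorem IsWeakNeumannSubsolution.of_univ {g : SmoothMetric n M} {u : M → ℝ}
    (h : IsWeakNeumannSubsolution g univ u) (D : Set M) :
    IsWeakNeumannSubsolution g D u := by
  obtain ⟨X, hX, hsub⟩ := h
  refine ⟨X, hX.mono (subset_univ D), fun φ hφ hφc hφD hφ0 ↦ ?_⟩
  have h1 := hsub φ hφ hφc (subset_univ _) hφ0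
  rw [setIntegral_univ] at h1
  rwa [setIntegral_eq_integral_of_forall_compl_eq_zero fun p hp ↦ ?_]
  rw [gradient_eq_zero_of_notMem_tsupport g fun h ↦ hp (hφD h), map_zero]

/-- If `H` is convex, nondecreasing and vanishes at `u` outside a closed subset of `D`, then `H ∘ u`
extended by zero is a weak Neumann subsolution on the whole manifold. -/
theorem IsWeakNeumannSubsolution.comp_extend [BorelSpace M] [T2Space M]
    [SecondCountableTopology M] {g : SmoothMetric n M} {D C : Set M} (hD : IsOpen D)
    (hC : IsClosed C) (hCD : C ⊆ D) {u v : M → ℝ} (hu : ContinuousOn u D) (hv : Continuous v)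
    (h : IsWeakNeumannSubsolution g D u) {H η : ℝ → ℝ} (hH : ∀ s, HasDerivAt H (η s) s)
    (hη : ContDiff ℝ ∞ η) (hη0 : ∀ s, 0 ≤ η s) (hηm : Monotone η)
    (hvH : ∀ p ∈ D, v p = H (u p)) (hv0 : ∀ p ∉ C, v p = 0)
    (hηC : ∀ p ∈ D, p ∉ C → η (u p) = 0) : IsWeakNeumannSubsolution g univ v := by
  classical
  obtain ⟨X, hX, hsub⟩ := h
  let Y : (p : M) → TangentSpace (𝓡∂ n) p := fun p ↦ if p ∈ D then η (u p) • X p else 0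
  have hYX : ∀ p ∈ D, Y p = η (u p) • X p := fun p hp ↦ if_pos hp
  have hY0 : ∀ p ∉ D ∩ u ⁻¹' (η ⁻¹' {0}ᶜ), Y p = 0 := by
    intro p hp
    by_cases hpD : p ∈ D
    · have : η (u p) = 0 := by
        by_contra h0
        exact hp ⟨hpD, h0⟩
      rw [hYX p hpD, this, zero_smul]
    · exact if_neg hpD
  have hUC : D ∩ u ⁻¹' (η ⁻¹' {0}ᶜ) ⊆ C := fun p hp ↦ by
    by_contra hpC
    exact hp.2 (hηC p hp.1 hpC)
  refine ⟨Y, hX.comp_extend hD hC hCD hu hv hH hη.continuous hvH hYX hv0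
    fun p hp ↦ hY0 p fun h ↦ hp (hUC h), fun φ hφ hφc _ hφ0 ↦ ?_⟩
  rw [setIntegral_univ, neg_nonneg]
  refine integral_inner_gradient_nonpos_of_local g hD hC hCD
    (hu.isOpen_inter_preimage hD (isOpen_compl_singleton.preimage hη.continuous)) hUC hY0
    (fun x φ hφ hφc hφD hφs hφ0 ↦ ?_) hφ hφc hφ0
  exact integral_inner_gradient_nonpos_of_tsupport_subset_source g hD hu hX hsub hη hη0 hηm hYX x
    hφ hφc hφD hφs hφ0

end Manifold

/-! ### The maximum principle -/

/-- Every nonempty open set contains interior points of the manifold other than a given point. -/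
theorem exists_mem_interior_ne {n : ℕ} [NeZero n] {M : Type*} [TopologicalSpace M]
    [ChartedSpace (EuclideanHalfSpace n) M] [IsManifold (𝓡∂ n) ∞ M] {U : Set M} (hU : IsOpen U)
    {p : M} (hp : p ∈ U) : ∃ q ∈ U, q ∈ (𝓡∂ n).interior M ∧ q ≠ p := by
  have hM : IsManifold (𝓡∂ n) 1 M := IsManifold.of_le (n := ∞) (by simp)
  obtain ⟨O, hO, hOU⟩ := exists_isOpen_target_inter_preimage (n := n) p hU
  set e := extChartAt (𝓡∂ n) p with he
  have hep : e p ∈ O ∩ range (𝓡∂ n) := by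
    rw [← hOU]
    refine ⟨mem_extChartAt_target p, ?_⟩
    rw [mem_preimage, extChartAt_to_inv]
    exact hp
  have hne : (O ∩ interior (range (𝓡∂ n))).Nonempty :=
    mem_closure_iff.1 ((𝓡∂ n).range_subset_closure_interior hep.2) O hO hep.1
  have hnb : NeBot (𝓝[≠] (e p)) := Module.punctured_nhds_neBot ℝ (Euc n) (e p)
  obtain ⟨y, ⟨hyO, hyr⟩, hye⟩ := (dense_compl_singleton (e p)).inter_open_nonempty _
    (hO.inter isOpen_interior) hne
  have hyS : y ∈ e.target ∩ e.symm ⁻¹' U := hOU ▸ ⟨hyO, interior_subset hyr⟩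
  have hyt : y ∈ interior e.target := by
    refine mem_interior_iff_mem_nhds.2 (Filter.mem_of_superset
      ((hO.inter isOpen_interior).mem_nhds ⟨hyO, hyr⟩) fun z hz ↦ ?_)
    exact (hOU.symm ▸ ⟨hz.1, interior_subset hz.2⟩ : z ∈ e.target ∩ e.symm ⁻¹' U).1
  refine ⟨e.symm y, hyS.2, ?_, fun h ↦ hye ?_⟩
  · have hsrc : e.symm y ∈ (chartAt (EuclideanHalfSpace n) p).source := by
      rw [← extChartAt_source (𝓡∂ n)]
      exact e.map_target hyS.1
    refine ((𝓡∂ n).isInteriorPoint_iff_of_mem_atlas one_ne_zero (chart_mem_atlas _ p) hsrc).2 ?_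
    change e (e.symm y) ∈ interior e.target
    rwa [e.right_inv hyS.1]
  · rw [mem_singleton_iff, ← h, e.right_inv hyS.1]

theorem exists_smooth_convex_cutoff (γ : ℝ) : ∃ H η : ℝ → ℝ, (∀ s, HasDerivAt H (η s) s) ∧
    ContDiff ℝ ∞ η ∧ (∀ s, 0 ≤ η s) ∧ Monotone η ∧ (∀ s ≤ γ, η s = 0) ∧ (∀ s ≤ γ, H s = 0) ∧
    ∀ s, γ < s → 0 < H s := by
  set η : ℝ → ℝ := fun s ↦ Real.smoothTransition (s - γ) with hη
  have hηc : ContDiff ℝ ∞ η :=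
    Real.smoothTransition.contDiff.comp (contDiff_id.sub contDiff_const)
  have hη0 : ∀ s ≤ γ, η s = 0 := fun s hs ↦
    Real.smoothTransition.zero_of_nonpos (sub_nonpos.2 hs)
  refine ⟨fun s ↦ ∫ t in γ..s, η t, η, fun s ↦ ?_, hηc, fun s ↦ Real.smoothTransition.nonneg _,
    fun a b hab ↦ Real.smoothTransition.monotone (sub_le_sub_right hab _), hη0, fun s hs ↦ ?_,
    fun s hs ↦ ?_⟩
  · exact intervalIntegral.integral_hasDerivAt_right (hηc.continuous.intervalIntegrable _ _)
      (hηc.continuous.stronglyMeasurableAtFilter _ _) hηc.continuous.continuousAt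
  · refine intervalIntegral.integral_zero_ae (.of_forall fun t ht ↦ hη0 t ?_)
    rw [uIoc_of_ge hs] at ht
    exact ht.2
  · exact intervalIntegral.intervalIntegral_pos_of_pos_on
      (hηc.continuous.intervalIntegrable _ _)
      (fun t ht ↦ Real.smoothTransition.pos_of_pos (sub_pos.2 ht.1)) hs

section Manifold

variable {n : ℕ} [NeZero n] {M : Type*} [TopologicalSpace M] [T2Space M]
  [ChartedSpace (EuclideanHalfSpace n) M] [IsManifold (𝓡∂ n) ∞ M] [MeasurableSpace M]

/-- The maximum principle on the complement of each interior point `p` shows that `p` is a maximum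
point of every bounded above subsolution. -/
theorem isParabolic_of_maximumPrinciple (g : SmoothMetric n M)
    (h : ∀ D : Set M, IsOpen D → (boundaryZero n D).Nonempty →
      frontier D ∩ (𝓡∂ n).boundary M ⊆ closure (boundaryZero n D) →
      ∀ u : M → ℝ, ContinuousOn u (closure D) → IsWeakNeumannSubsolution g D u →
        BddAbove (u '' D) → sSup (u '' D) = sSup (u '' boundaryZero n D)) : IsParabolic g := by
  intro u hu hsub hbdd
  have hmax : ∀ p ∈ (𝓡∂ n).interior M, ∀ q, u q ≤ u p := by
    intro p hp q
    rcases eq_or_ne q p with rfl | hqp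
    · exact le_rfl
    have hdense : closure ({p}ᶜ : Set M) = univ := by
      refine (dense_iff_inter_open.2 fun U hU hUne ↦ ?_).closure_eq
      obtain ⟨z, hz⟩ := hUne
      rcases eq_or_ne z p with rfl | hzp
      · obtain ⟨y, hy, -, hyz⟩ := exists_mem_interior_ne (n := n) hU hz
        exact ⟨y, hy, hyz⟩
      · exact ⟨z, hz, hzp⟩
    have hfr : frontier ({p}ᶜ : Set M) = {p} := by
      rw [isOpen_compl_singleton.frontier_eq, hdense, ← compl_eq_univ_sdiff, compl_compl]
    have hb : boundaryZero n ({p}ᶜ : Set M) = {p} := by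
      rw [boundaryZero, hfr]
      exact inter_eq_self_of_subset_left (singleton_subset_iff.2 hp)
    have hbd : BddAbove (u '' {p}ᶜ) := hbdd.mono (image_subset_range _ _)
    have h1 := h {p}ᶜ isOpen_compl_singleton (by rw [hb]; exact singleton_nonempty p)
      (by rw [hb, hfr]; exact inter_subset_left.trans subset_closure) u hu.continuousOn
      (hsub.of_univ _) hbd
    rw [hb, image_singleton, csSup_singleton] at h1
    exact h1 ▸ le_csSup hbd (mem_image_of_mem u hqp)
  rcases isEmpty_or_nonempty M with hM | ⟨⟨p⟩⟩
  · exact ⟨0, fun p ↦ hM.elim p⟩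
  obtain ⟨p₀, -, hp₀, -⟩ := exists_mem_interior_ne (n := n) isOpen_univ (mem_univ p)
  have hdense : Dense ((𝓡∂ n).interior M) := dense_iff_inter_open.2 fun U hU ⟨z, hz⟩ ↦ by
    obtain ⟨y, hy, hyi, -⟩ := exists_mem_interior_ne (n := n) hU hz
    exact ⟨y, hy, hyi⟩
  have heq : u = fun _ ↦ u p₀ := hu.ext_on hdense continuous_const fun q hq ↦
    le_antisymm (hmax p₀ hp₀ q) (hmax q hq p₀)
  exact ⟨u p₀, fun q ↦ congrFun heq q⟩

/-- Were the maximum principle violated at a level `γ`, a smooth convex function of `u` that is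
constant below `γ` could be extended to a nonconstant subsolution on the whole manifold. -/
theorem IsParabolic.sSup_image_eq [BorelSpace M] [SecondCountableTopology M]
    {g : SmoothMetric n M} (h : IsParabolic g) {D : Set M} (hD : IsOpen D)
    (hne : (boundaryZero n D).Nonempty)
    (hfr : frontier D ∩ (𝓡∂ n).boundary M ⊆ closure (boundaryZero n D)) {u : M → ℝ}
    (hu : ContinuousOn u (closure D)) (hsub : IsWeakNeumannSubsolution g D u)
    (hbdd : BddAbove (u '' D)) : sSup (u '' D) = sSup (u '' boundaryZero n D) := by
  classical
  have hbc : boundaryZero n D ⊆ closure D := inter_subset_left.trans frontier_subset_closure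
  have hDne : D.Nonempty := closure_nonempty_iff.1 (hne.mono hbc)
  have hle : ∀ p ∈ closure D, u p ≤ sSup (u '' D) := fun p hp ↦
    closure_minimal (fun _ ht ↦ le_csSup hbdd ht) isClosed_Iic
      (hu.image_closure (mem_image_of_mem u hp))
  have hbb : BddAbove (u '' boundaryZero n D) := by
    refine ⟨sSup (u '' D), ?_⟩
    rintro _ ⟨p, hp, rfl⟩
    exact hle p (hbc hp)
  refine le_antisymm (not_lt.1 fun hlt ↦ ?_) (csSup_le (hne.image u) ?_)
  swap
  · rintro _ ⟨p, hp, rfl⟩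
    exact hle p (hbc hp)
  obtain ⟨γ, hγ1, hγ2⟩ := exists_between hlt
  have hb0 : ∀ p ∈ closure (boundaryZero n D), u p < γ := fun p hp ↦
    lt_of_le_of_lt (closure_minimal (fun _ ht ↦ le_csSup hbb ht) isClosed_Iic
      ((hu.mono (closure_minimal hbc isClosed_closure)).image_closure (mem_image_of_mem u hp))) hγ1
  set C := closure D ∩ u ⁻¹' Ici γ with hCdef
  have hC : IsClosed C := hu.preimage_isClosed_of_isClosed isClosed_closure isClosed_Ici
  have hCD : C ⊆ D := by
    rintro p ⟨hp, hpγ⟩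
    by_contra hpD
    have hpf : p ∈ frontier D := by
      rw [hD.frontier_eq]
      exact ⟨hp, hpD⟩
    refine (hb0 p ?_).not_ge hpγ
    rcases (𝓡∂ n).isInteriorPoint_or_isBoundaryPoint p with hpi | hpb
    · exact subset_closure ⟨hpf, hpi⟩
    · exact hfr ⟨hpf, hpb⟩
  have hlow : ∀ p ∈ D, p ∉ C → u p ≤ γ := fun p hp hpC ↦ by
    by_contra! hlt'
    exact hpC ⟨subset_closure hp, hlt'.le⟩
  obtain ⟨H, η, hH, hη, hη0, hηm, hηγ, hHγ, hHpos⟩ := exists_smooth_convex_cutoff γ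
  have hHc : Continuous H := continuous_iff_continuousAt.2 fun s ↦ (hH s).continuousAt
  have hHm : Monotone H := monotone_of_hasDerivAt_nonneg hH hη0
  have huD : ContinuousOn u D := hu.mono subset_closure
  set v : M → ℝ := fun p ↦ if p ∈ D then H (u p) else 0 with hvdef
  have hvH : ∀ p ∈ D, v p = H (u p) := fun p hp ↦ if_pos hp
  have hv0 : ∀ p ∉ C, v p = 0 := fun p hp ↦ by
    by_cases hpD : p ∈ D
    · rw [hvH p hpD, hHγ _ (hlow p hpD hp)]
    · exact if_neg hpD
  have hvc : Continuous v := by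
    refine continuous_iff_continuousAt.2 fun p ↦ ?_
    by_cases hp : p ∈ C
    · have hpD := hD.mem_nhds (hCD hp)
      exact (hHc.continuousAt.comp (huD.continuousAt hpD)).congr_of_eventuallyEq
        (Filter.mem_of_superset hpD hvH)
    · exact continuousAt_const.congr_of_eventuallyEq
        (Filter.mem_of_superset (hC.isOpen_compl.mem_nhds hp) hv0)
  have hvsub := hsub.comp_extend hD hC hCD huD hvc hH hη hη0 hηm hvH hv0
    fun p hp hpC ↦ hηγ _ (hlow p hp hpC)
  have hvb : BddAbove (range v) := by
    refine ⟨H (sSup (u '' D)), ?_⟩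
    rintro _ ⟨p, rfl⟩
    by_cases hp : p ∈ D
    · rw [hvH p hp]
      exact hHm (le_csSup hbdd (mem_image_of_mem u hp))
    · simp only [hvdef, if_neg hp]
      exact (hHpos _ hγ2).le
  obtain ⟨c, hc⟩ := h v hvc hvsub hvb
  obtain ⟨b, hb⟩ := hne
  obtain ⟨_, ⟨p, hp, rfl⟩, hpγ⟩ := exists_lt_of_lt_csSup (hDne.image u) hγ2
  have h1 : v b = 0 := hv0 b fun hbC ↦ (hb0 b (subset_closure hb)).not_ge hbC.2
  have h2 := hHpos _ hpγ
  rw [← hvH p hp, hc, ← hc b, h1] at h2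
  exact lt_irrefl _ h2

end Manifold

end NeumannParabolic

theorem mainTheorem1 (n : ℕ) [NeZero n] (M : Type*) [TopologicalSpace M] [T2Space M]
    [SecondCountableTopology M] [MeasurableSpace M] [BorelSpace M]
    [ChartedSpace (EuclideanHalfSpace n) M] [IsManifold (𝓡∂ n) ∞ M] (g : SmoothMetric n M) :
    NeumannParabolic.IsParabolic g ↔
      ∀ D : Set M, IsOpen D → (NeumannParabolic.boundaryZero n D).Nonempty →
        frontier D ∩ (𝓡∂ n).boundary M ⊆ closure (NeumannParabolic.boundaryZero n D) →
        ∀ u : M → ℝ, ContinuousOn u (closure D) →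
          NeumannParabolic.IsWeakNeumannSubsolution g D u → BddAbove (u '' D) →
          sSup (u '' D) = sSup (u '' NeumannParabolic.boundaryZero n D) :=
  ⟨fun h _ hD hne hfr _ hu hsub hbdd ↦ h.sSup_image_eq hD hne hfr hu hsub hbdd,
    NeumannParabolic.isParabolic_of_maximumPrinciple g⟩
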